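/- **Setting.** Let $\mathcal S,\mathcal A$ be finite sets, $\mathcal A\neq\emptyset$, $H\ge 1$, and consider an episodic linear MDP with initial distribution $\nu_0$ and transition kernels $P_1,\dots,P_H$: there are features $\phi:\mathcal S\times\mathcal A\to\mathbb R^d$ (known) and matrices $M_h\in\mathbb R^{d\times|\mathcal S|}$ (unknown) with $P_h(s'|s,a)=\sum_i\phi_i(s,a)M_h(i,s')$, $\|\phi(s,a)\|_1\le 1$ for all $(s,a)$ and $\sum_{s'}|M_h(i,s')|\le 1$ for all $h,i$. For a Markov policy $\pi=(\pi_h)_{h\le H}$ and a cost $c=(c_h)_{h\le H}$ put $V_1^\pi(s;c)=\mathbb E\big[\sum_{h=1}^H c_h(s_h,a_h)\mid s_1=s\big]$; for weights $w=(w_h)_{h\le H}$ write $c_h=\Phi w_h$ for $c_h(s,a)=\langle\phi(s,a),w_h\rangle$. Initial states are drawn from $\nu_0$ (a fixed $s_1$ is the case of a point mass). **LSVI-UCB with costs revealed one round in advance.** $\pi^1$ is uniform. After episodes $1,\dots,k$ the weights $w^{k+1}$ are revealed (they may depend arbitrarily on these episodes). With $\mathcal D_h$ the transitions $(s,a,s')$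 observed at stage $h$ in these episodes and $V_{H+1}=0$, compute for $h=H,\dots,1$: $\Lambda_h=I+\sum_{\mathcal D_h}\phi\phi^\top$, $v_h=\Lambda_h^{-1}\sum_{\mathcal D_h}\phi(s,a)V_{h+1}(s')$, $Q_h=\Phi w^{k+1}_h+\Phi v_h-\beta\|\phi\|_{\Lambda_h^{-1}}$ truncated to $[-(H-h+1),H-h+1]$, $\pi^{k+1}_h(s)\in\arg\min_a Q_h(s,a)$ (any fixed tie-breaking rule), $V_h(s)=\min_a Q_h(s,a)$. Episode $k+1$ is played with $\pi^{k+1}$ and cost $c^{k+1}=\Phi w^{k+1}$. **BRIG.** Let $\mathcal W$ be $[0,1]^d$ or the Euclidean unit ball of $\mathbb R^d$. From $\tau_E$ independent episodes of an arbitrary Markov policy $\pi_E$ compute the empirical means $\widehat\Phi_{E,h}$ of $\phi(s_h,a_h)$. Start from any $w^1_h\in\mathcal W$, and after episode $k$ first update the cost, $w_h^{k+1}=\Pi_{\mathcal W}\big[w_h^k-\alpha(\widehat\Phi_{E,h}-\phi(s_h^k,a_h^k))\big]$ for all $h$, then compute $\pi^{k+1}$ by LSVI-UCB with the known next cost $\Phi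 w^{k+1}$. **Theorem.** There are absolute constants $c,C_0,C>0$ such that the following holds for every such MDP, every $\delta\in(0,1)$ and every number $K$ of episodes, with $\beta=c\,dH\sqrt{\log(dHK/\delta)}$. 1. (Regret.) For every sequence of weights chosen adaptively as above with $\|w_h^k\|_\infty\le 1$, LSVI-UCB satisfies with probability at least $1-2\delta$, simultaneously for all Markov policies $\pi^\star$, $$\sum_{k=1}^K\mathbb E_{s_1\sim\nu_0}\big[V_1^{\pi^k}(s_1;c^k)-V_1^{\pi^\star}(s_1;c^k)\big]\le C\,H^2d^{3/2}\sqrt K\,\log(dHK/\delta).$$ 2. (BRIG.) Let $c_{\rm true}=\Phi w_{\rm true}$ with $w_{{\rm true},h}\in\mathcal W$ for all $h$, let $\epsilon\in(0,1]$, $\epsilon_E>0$, $\alpha=1/\sqrt{2K}$, $$K\ge C_0\,\frac{H^4d^3\log^2\!\big(dH/(\epsilon\delta)\big)}{\epsilon^2},\qquad \tau_E\ge\frac{2H^2d\log(2d/\delta)}{\epsilon_E^2}.$$ Then with probability at least $1-3\delta$ over the expert data and the $K$ episodes of BRIG, for $\hat k$ uniform on $\{1,\dots,K\}$, $$\mathbb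 E_{\hat k}\,\mathbb E_{s_1\sim\nu_0}\big[V_1^{\pi^{\hat k}}(s_1;c_{\rm true})-V_1^{\pi_E}(s_1;c_{\rm true})\big]\le C(\epsilon_E+\epsilon).$$ -/

import Mathlib

open scoped Matrix

universe u v

noncomputable section

namespace Brig

/-! ## Episodic linear MDPs

Stages are indexed by `Fin H`, so the stage `h : Fin H` is the stage `h + 1` of the usual
numbering `1, …, H`. -/

/-- An episodic linear MDP with finite state and action spaces: initial distribution, stage
dependent transition kernels, features `φ` (known to the learner) and matrices `M` (unknown to the
learner) with `P_h = Φ M_h`, `‖Φ‖_{1,∞} ≤ 1` and `‖M_h‖_{1,∞} ≤ 1`, where `‖·‖_{1,∞}` is the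
largest `ℓ¹`-norm of a row. -/
structure LinearMDP (S : Type u) (A : Type v) [Fintype S] (d H : ℕ) where
  /-- distribution of the initial state -/
  init : PMF S
  /-- transition kernels -/
  P : Fin H → S → A → PMF S
  /-- feature map -/
  φ : S → A → Fin d → ℝ
  /-- right factors of the transition matrices -/
  M : Fin H → Fin d → S → ℝ
  factor : ∀ h s a s', (P h s a s').toReal = ∑ i, φ s a i * M h i s'
  feature_norm : ∀ s a, ∑ i, |φ s a i| ≤ 1
  factor_norm : ∀ h i, ∑ s', |M h i s'| ≤ 1

/-- A (stochastic, stage dependent) Markov policy. -/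
abbrev Policy (S : Type u) (A : Type v) (H : ℕ) := Fin H → S → PMF A

/-- An episode: the transition `(s_h, a_h, s_{h+1})` of every stage. -/
abbrev Episode (S : Type u) (A : Type v) (H : ℕ) := Fin H → S × A × S

/-- A stage dependent cost function. -/
abbrev Cost (S : Type u) (A : Type v) (H : ℕ) := Fin H → S → A → ℝ

/-- Law of the `n` transitions that follow when the policy `π` is played from the state `s`. -/
def rollout {S : Type u} {A : Type v} :
    (n : ℕ) → (Fin n → S → A → PMF S) → Policy S A n → S → PMF (Episode S A n)
  | 0, _, _, _ => PMF.pure Fin.elim0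
  | n + 1, P, π, s =>
      (π 0 s).bind fun a => (P 0 s a).bind fun s' =>
        (rollout n (fun i => P i.succ) (fun i => π i.succ) s').map
          fun x => Fin.cons (α := fun _ => S × A × S) (s, a, s') x

variable {S : Type u} {A : Type v} [Fintype S] {d H : ℕ}

/-- Law of an episode played with the policy `π`, from a random initial state. -/
def LinearMDP.episodeLaw (mdp : LinearMDP S A d H) (π : Policy S A H) : PMF (Episode S A H) :=
  mdp.init.bind fun s => rollout H mdp.P π s

/-- The state value function `V₁^π(s; c) = E[∑_h c_h(s_h, a_h) | s₁ = s]`. -/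
def LinearMDP.value [Fintype A] (mdp : LinearMDP S A d H) (π : Policy S A H) (c : Cost S A H)
    (s : S) : ℝ :=
  ∑ x : Episode S A H, (rollout H mdp.P π s x).toReal * ∑ h, c h (x h).1 (x h).2.1

/-- The expected gap `E_{s₁ ∼ ν₀}[V₁^π(s₁; c) - V₁^{π'}(s₁; c)]`. -/
def LinearMDP.gap [Fintype A] (mdp : LinearMDP S A d H) (π π' : Policy S A H) (c : Cost S A H) :
    ℝ :=
  ∑ s, (mdp.init s).toReal * (mdp.value π c s - mdp.value π' c s)

/-- The linear cost `c_h(s, a) = ⟨φ(s, a), w_h⟩`. -/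
def linearCost (φ : S → A → Fin d → ℝ) (w : Fin H → Fin d → ℝ) : Cost S A H :=
  fun h s a => φ s a ⬝ᵥ w h

/-! ## Repeated interaction -/

/-- A rule that selects a policy from the episodes observed so far. -/
abbrev Learner (S : Type u) (A : Type v) (H : ℕ) :=
  (k : ℕ) → (Fin k → Episode S A H) → Policy S A H

/-- Joint law of `n` episodes: each is played with the policy that the learner selects from the
previous ones. -/
def LinearMDP.interact (mdp : LinearMDP S A d H) (L : Learner S A H) :
    (n : ℕ) → PMF (Fin n → Episode S A H)
  | 0 => PMF.pure Fin.elim0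
  | n + 1 => (mdp.interact L n).bind fun hist =>
      (mdp.episodeLaw (L n hist)).map
        fun e => Fin.snoc (α := fun _ => Episode S A H) hist e

/-- The episodes that precede the episode number `k`. -/
def past {K : ℕ} (run : Fin K → Episode S A H) (k : Fin K) : Fin k → Episode S A H :=
  fun l => run (Fin.castLE k.isLt.le l)

/-! ## LSVI-UCB with costs that are revealed one round in advance -/

/-- `Λ = I + ∑ φ φᵀ`, the sum over the transitions in the data set `D`. -/
def gram (φ : S → A → Fin d → ℝ) {k : ℕ} (D : Fin k → S × A × S) : Matrix (Fin d) (Fin d) ℝ :=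
  1 + ∑ l, Matrix.vecMulVec (φ (D l).1 (D l).2.1) (φ (D l).1 (D l).2.1)

/-- The regression vector `Λ⁻¹ ∑ φ(s, a) V(s')`. -/
def regress (φ : S → A → Fin d → ℝ) {k : ℕ} (D : Fin k → S × A × S) (V : S → ℝ) : Fin d → ℝ :=
  (gram φ D)⁻¹ *ᵥ ∑ l, V (D l).2.2 • φ (D l).1 (D l).2.1

/-- The exploration bonus `β ‖φ(s, a)‖_{Λ⁻¹}`. -/
def bonus (φ : S → A → Fin d → ℝ) (β : ℝ) {k : ℕ} (D : Fin k → S × A × S) (s : S) (a : A) : ℝ :=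
  β * √(φ s a ⬝ᵥ ((gram φ D)⁻¹ *ᵥ φ s a))

/-- Truncation to `[-r, r]`. -/
def clip (r x : ℝ) : ℝ := max (-r) (min r x)

/-- One backward step: the optimistic action values of stage `h` when `V` are the values of the
next stage. The truncation level is the number `H - h` of stages to go. -/
def lsviStep (φ : S → A → Fin d → ℝ) (β : ℝ) (w : Fin H → Fin d → ℝ) {k : ℕ}
    (hist : Fin k → Episode S A H) (h : Fin H) (V : S → ℝ) (s : S) (a : A) : ℝ :=
  clip ((H : ℝ) - (h : ℕ))
    (φ s a ⬝ᵥ w h + φ s a ⬝ᵥ regress φ (fun l => hist l h) V - bonus φ β (fun l => hist l h) s a)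

/-- The optimistic state values, by backward recursion from `V = 0` after the last stage; `am q`
is a minimiser of `q`. -/
def lsviV (φ : S → A → Fin d → ℝ) (am : (A → ℝ) → A) (β : ℝ) (w : Fin H → Fin d → ℝ) {k : ℕ}
    (hist : Fin k → Episode S A H) : Fin (H + 1) → S → ℝ :=
  fun i => Fin.reverseInduction (motive := fun _ => S → ℝ) (fun _ => 0)
    (fun h V s => lsviStep φ β w hist h V s (am (lsviStep φ β w hist h V s))) i

/-- The optimistic action values. -/
def lsviQ (φ : S → A → Fin d → ℝ) (am : (A → ℝ) → A) (β : ℝ) (w : Fin H → Fin d → ℝ) {k : ℕ}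
    (hist : Fin k → Episode S A H) (h : Fin H) : S → A → ℝ :=
  lsviStep φ β w hist h (lsviV φ am β w hist h.succ)

/-- A rule that selects the cost weights of the next episode from the episodes observed so far. -/
abbrev CostPlayer (S : Type u) (A : Type v) (d H : ℕ) :=
  (k : ℕ) → (Fin k → Episode S A H) → Fin H → Fin d → ℝ

/-- LSVI-UCB against the cost player `W`: the first policy is uniform, every later one is greedy
for the optimistic action values that are computed from the past episodes and the cost weights
*of the episode that is about to be played*. -/
def lsviUCB [Fintype A] [Nonempty A] (φ : S → A → Fin d → ℝ) (am : (A → ℝ) → A) (β : ℝ)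
    (W : CostPlayer S A d H) : Learner S A H
  | 0, _ => fun _ _ => PMF.uniformOfFintype A
  | k + 1, hist => fun h s => PMF.pure (am (lsviQ φ am β (W (k + 1) hist) hist h s))

/-- The regret `∑_k E_{s₁}[V₁^{π^k}(s₁; c^k) - V₁^{π⋆}(s₁; c^k)]` of LSVI-UCB on a run. -/
def LinearMDP.regret [Fintype A] [Nonempty A] (mdp : LinearMDP S A d H) (am : (A → ℝ) → A) (β : ℝ)
    (W : CostPlayer S A d H) {K : ℕ} (run : Fin K → Episode S A H) (πs : Policy S A H) : ℝ :=
  ∑ k : Fin K, mdp.gap (lsviUCB mdp.φ am β W k (past run k)) πs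
    (linearCost mdp.φ (W k (past run k)))

/-! ## BRIG -/

/-- The box `[0, 1]^d`. -/
def unitBox (d : ℕ) : Set (Fin d → ℝ) := {w | ∀ i, 0 ≤ w i ∧ w i ≤ 1}

/-- The Euclidean unit ball. -/
def unitBall (d : ℕ) : Set (Fin d → ℝ) := {w | ‖WithLp.toLp 2 w‖ ≤ 1}

/-- The Euclidean projection onto `W` (a nonempty closed convex set). -/
def proj (W : Set (Fin d → ℝ)) (x : Fin d → ℝ) : Fin d → ℝ :=
  Classical.epsilon fun p =>
    p ∈ W ∧ ∀ y ∈ W, ‖WithLp.toLp 2 (x - p)‖ ≤ ‖WithLp.toLp 2 (x - y)‖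

/-- The empirical expert feature expectation of stage `h`. -/
def expertFeatures (φ : S → A → Fin d → ℝ) {N : ℕ} (D : Fin N → Episode S A H) (h : Fin H) :
    Fin d → ℝ :=
  (N : ℝ)⁻¹ • ∑ i, φ (D i h).1 (D i h).2.1

/-- The cost player of BRIG: projected online gradient descent with step size `α`,
`w^{k+1}_h = Π_W[w^k_h - α (Φ̂_{E,h} - φ(s^k_h, a^k_h))]`, started at `w₁`. -/
def ogd (φ : S → A → Fin d → ℝ) (W : Set (Fin d → ℝ)) (α : ℝ) (w₁ : Fin H → Fin d → ℝ) {N : ℕ}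
    (D : Fin N → Episode S A H) : CostPlayer S A d H
  | 0, _ => w₁
  | k + 1, hist => fun h =>
      proj W (ogd φ W α w₁ D k (fun l => hist l.castSucc) h -
        α • (expertFeatures φ D h - φ (hist (Fin.last k) h).1 (hist (Fin.last k) h).2.1))

/-- The learner BRIG, given the expert data `D`: LSVI-UCB played against the gradient descent
cost player. -/
def brig [Fintype A] [Nonempty A] (φ : S → A → Fin d → ℝ) (am : (A → ℝ) → A) (β : ℝ)
    (W : Set (Fin d → ℝ)) (α : ℝ) (w₁ : Fin H → Fin d → ℝ) {N : ℕ}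
    (D : Fin N → Episode S A H) : Learner S A H :=
  lsviUCB φ am β (ogd φ W α w₁ D)

/-- Joint law of the `N` independent expert episodes and the `K` episodes that BRIG plays. -/
def LinearMDP.brigLaw [Fintype A] [Nonempty A] (mdp : LinearMDP S A d H) (πE : Policy S A H)
    (am : (A → ℝ) → A) (β : ℝ) (W : Set (Fin d → ℝ)) (α : ℝ) (w₁ : Fin H → Fin d → ℝ)
    (N K : ℕ) : PMF ((Fin N → Episode S A H) × (Fin K → Episode S A H)) :=
  (mdp.interact (fun _ _ => πE) N).bind fun D =>
    (mdp.interact (brig mdp.φ am β W α w₁ D) K).map fun run => (D, run)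

/-- The exploration parameter `β = c d H √(log(d H K / δ))`. -/
def explorationParam (c : ℝ) (d H K : ℕ) (δ : ℝ) : ℝ :=
  c * d * H * √(Real.log (d * H * K / δ))

end Brig

end

/-!
All spaces are finite, so every probability is handled through the finite sums `expect`. A high
probability event is always derived in the same way: a nonnegative function `f` of small
expectation is exhibited, and the claim is shown to hold, deterministically, wherever `f < 1`. The
functions `f` are sums of exponential supermartingales along the interaction.

*Regret.* In a linear MDP `s, a ↦ E[V(s') | s, a]` is linear in `φ(s, a)`, so that the ridge
regression of LSVI-UCB estimates it up to `‖φ(s, a)‖_{Λ⁻¹}` times the self-normalised norm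
`‖∑ φ_l (V(s'_l) - E V)‖_{Λ⁻¹}`. The next values `V` depend on the data, but they lie in a class
with `d + d²` bounded parameters, which does not mind that the cost weights of the coming episode
depend on the past: these weights only shift a parameter. A union bound runs over a grid of value
functions and, at the same time, over a grid of directions `θ`; for fixed `V` and `θ` the process
`exp (∑ θᵀφ_l (V(s'_l) - E V) - 2H² (θᵀφ_l)²)` is a supermartingale
(`expect_interact_exp_conf_le_one`). Replacing the norm by directions makes the method of mixtures
unnecessary, since the grid of value functions already costs a factor `d²` in the logarithm. Thus
the bonus dominates the regression error (`abs_dotProduct_regress_sub_expect_le`), the values are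
optimistic (`lsviV_zero_le_value`), and the regret of an episode is at most twice the expected sum
of the bonuses (`gap_greedy_le`). The Azuma–Hoeffding inequality passes to the observed bonuses,
and the elliptical potential (`sum_bonus_le`) bounds their sum.

*BRIG.* The gap for the true cost equals the gap for the current cost plus three terms
(`gap_linearCost_sub`): the error of the expert's empirical features, the regret of gradient
descent and a martingale difference. The sum of the gaps for the current costs is the regret of
LSVI-UCB against the expert. For the expert's features a dimension free bound is needed that does
not lose `log H` in a union bound over the stages. It comes from gradient descent once more
(`exists_weight_expertFeatures_le`): descent on the unit ball, run on the expert data, competes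
with every direction, and its own correlation with the noise is a scalar martingale.
-/

noncomputable section

namespace Brig

/-! ### Expectations over finite probability spaces -/

/-- The expectation of `f` under the law `p` on a finite type, as a finite sum. -/
def expect {α : Type*} [Fintype α] (p : PMF α) (f : α → ℝ) : ℝ := ∑ x, (p x).toReal * f x

section Expect

variable {α β : Type*} [Fintype α] [Fintype β]

lemma sum_toReal_eq_one (p : PMF α) : ∑ x, (p x).toReal = 1 := by
  rw [← ENNReal.toReal_sum (fun x _ => p.apply_ne_top x), ← tsum_fintype (L := .unconditional _),
    p.tsum_coe, ENNReal.toReal_one]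

@[simp] lemma expect_const (p : PMF α) (c : ℝ) : expect p (fun _ => c) = c := by
  rw [expect, ← Finset.sum_mul, sum_toReal_eq_one, one_mul]

lemma expect_mono (p : PMF α) {f g : α → ℝ} (h : ∀ x, f x ≤ g x) : expect p f ≤ expect p g :=
  Finset.sum_le_sum fun x _ => mul_le_mul_of_nonneg_left (h x) ENNReal.toReal_nonneg

lemma expect_le (p : PMF α) {f : α → ℝ} {c : ℝ} (h : ∀ x, f x ≤ c) : expect p f ≤ c :=
  (expect_mono p h).trans_eq (expect_const p c)

lemma le_expect (p : PMF α) {f : α → ℝ} {c : ℝ} (h : ∀ x, c ≤ f x) : c ≤ expect p f :=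
  (expect_const p c).symm.trans_le (expect_mono p h)

lemma expect_nonneg (p : PMF α) {f : α → ℝ} (h : ∀ x, 0 ≤ f x) : 0 ≤ expect p f :=
  le_expect p h

lemma expect_add (p : PMF α) (f g : α → ℝ) :
    expect p (fun x => f x + g x) = expect p f + expect p g := by
  simp only [expect, mul_add, Finset.sum_add_distrib]

lemma expect_sub (p : PMF α) (f g : α → ℝ) :
    expect p (fun x => f x - g x) = expect p f - expect p g := by
  simp only [expect, mul_sub, Finset.sum_sub_distrib]

lemma expect_const_mul (p : PMF α) (c : ℝ) (f : α → ℝ) :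
    expect p (fun x => c * f x) = c * expect p f := by
  simp only [expect, Finset.mul_sum]
  exact Finset.sum_congr rfl fun x _ => by ring

lemma expect_mul_const (p : PMF α) (f : α → ℝ) (c : ℝ) :
    expect p (fun x => f x * c) = expect p f * c := by
  simp only [mul_comm _ c, expect_const_mul]

lemma expect_neg (p : PMF α) (f : α → ℝ) : expect p (fun x => -f x) = -expect p f := by
  simp [expect]

lemma expect_sum {ι : Type*} (s : Finset ι) (p : PMF α) (f : ι → α → ℝ) :
    expect p (fun x => ∑ i ∈ s, f i x) = ∑ i ∈ s, expect p (f i) := by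
  simp only [expect, Finset.mul_sum]
  exact Finset.sum_comm

lemma abs_expect_le (p : PMF α) {f : α → ℝ} {c : ℝ} (h : ∀ x, |f x| ≤ c) : |expect p f| ≤ c :=
  abs_le.2 ⟨le_expect p fun x => (abs_le.1 (h x)).1, expect_le p fun x => (abs_le.1 (h x)).2⟩

lemma expect_pure (a : α) (f : α → ℝ) : expect (PMF.pure a) f = f a := by
  classical
  rw [expect, Finset.sum_eq_single a]
  · simp
  · intro b _ hb
    simp [PMF.pure_apply, hb]
  · simp

lemma expect_bind (p : PMF α) (q : α → PMF β) (f : β → ℝ) :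
    expect (p.bind q) f = expect p fun x => expect (q x) f := by
  simp only [expect, PMF.bind_apply, tsum_fintype, Finset.mul_sum]
  rw [Finset.sum_comm]
  refine Finset.sum_congr rfl fun y _ => ?_
  rw [ENNReal.toReal_sum fun x _ => ENNReal.mul_ne_top (p.apply_ne_top x) ((q x).apply_ne_top y),
    Finset.sum_mul]
  exact Finset.sum_congr rfl fun x _ => by rw [ENNReal.toReal_mul, mul_assoc]

lemma expect_map (p : PMF α) (g : α → β) (f : β → ℝ) :
    expect (p.map g) f = expect p fun x => f (g x) := by
  rw [← PMF.bind_pure_comp, expect_bind]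
  simp only [Function.comp, expect_pure]

/-- Markov's inequality in the form in which high probability events are derived: the event `good`
contains the event `f < 1`. -/
lemma ofReal_one_sub_le_toOuterMeasure (p : PMF α) {good : α → Prop} {f : α → ℝ} {η : ℝ}
    (hf : ∀ x, 0 ≤ f x) (hgood : ∀ x, f x < 1 → good x) (hη : expect p f ≤ η) :
    ENNReal.ofReal (1 - η) ≤ p.toOuterMeasure {x | good x} := by
  classical
  have h1 : p.toOuterMeasure {x | good x} =
      ENNReal.ofReal (expect p fun x => if good x then 1 else 0) := by
    rw [PMF.toOuterMeasure_apply_fintype, expect, ENNReal.ofReal_sum_of_nonneg]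
    · refine Finset.sum_congr rfl fun x _ => ?_
      by_cases hx : good x <;> simp [hx, p.apply_ne_top x]
    · intro x _
      split_ifs <;> simp
  rw [h1]
  apply ENNReal.ofReal_le_ofReal
  calc 1 - η ≤ 1 - expect p f := by linarith
    _ = expect p (fun x => 1 - f x) := by rw [expect_sub, expect_const]
    _ ≤ _ := expect_mono p fun x => by
      split_ifs with hx
      · linarith [hf x]
      · have := mt (hgood x) hx
        linarith

/-- Hoeffding's lemma for symmetric bounds. -/
lemma expect_exp_le_of_abs_le (p : PMF α) {f : α → ℝ} {b : ℝ} (hf : ∀ x, |f x| ≤ b)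
    (h0 : expect p f = 0) (t : ℝ) :
    expect p (fun x => Real.exp (t * f x)) ≤ Real.exp (t ^ 2 * b ^ 2 / 2) := by
  rcases le_or_gt b 0 with hb | hb
  · have hf0 : ∀ x, f x = 0 := fun x => abs_nonpos_iff.1 ((hf x).trans hb)
    simp only [hf0, mul_zero, Real.exp_zero, expect_const]
    exact Real.one_le_exp (by positivity)
  · -- by convexity, `exp (t y)` lies below its chord on `[-b, b]`
    have key : ∀ x, Real.exp (t * f x) ≤ Real.cosh (t * b) + f x * (Real.sinh (t * b) / b) := by
      intro x
      obtain ⟨h1, h2⟩ := abs_le.1 (hf x)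
      have hc := convexOn_exp.2 (Set.mem_univ (t * b)) (Set.mem_univ (-(t * b)))
        (show 0 ≤ (b + f x) / (2 * b) from div_nonneg (by linarith) (by linarith))
        (show 0 ≤ (b - f x) / (2 * b) from div_nonneg (by linarith) (by linarith))
        (by field_simp; ring)
      have e1 : ((b + f x) / (2 * b)) • (t * b) + ((b - f x) / (2 * b)) • -(t * b) = t * f x := by
        simp only [smul_eq_mul]; field_simp; ring
      rw [e1] at hc
      refine hc.trans_eq ?_
      rw [Real.cosh_eq, Real.sinh_eq]
      simp only [smul_eq_mul]; field_simp; ring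
    calc _ ≤ expect p (fun x => Real.cosh (t * b) + f x * (Real.sinh (t * b) / b)) :=
          expect_mono p key
      _ = Real.cosh (t * b) := by
          rw [expect_add, expect_const, expect_mul_const, h0]; ring
      _ ≤ _ := (Real.cosh_le_exp_half_sq _).trans_eq (by rw [mul_pow])

end Expect

/-! ### Expectations along an episode -/

lemma past_snoc_castSucc {S : Type u} {A : Type v} {H n : ℕ} (hist : Fin n → Episode S A H)
    (e : Episode S A H) (j : Fin n) :
    past (Fin.snoc (α := fun _ => Episode S A H) hist e) j.castSucc = past hist j := by
  funext l
  exact Fin.snoc_castSucc (α := fun _ => Episode S A H) e hist (Fin.castLE j.isLt.le l)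

lemma past_snoc_last {S : Type u} {A : Type v} {H n : ℕ} (hist : Fin n → Episode S A H)
    (e : Episode S A H) :
    past (Fin.snoc (α := fun _ => Episode S A H) hist e) (Fin.last n) = hist := by
  funext l
  exact Fin.snoc_castSucc (α := fun _ => Episode S A H) e hist l

section Rollout

variable {S : Type u} {A : Type v} [Fintype S] [Fintype A] {d H : ℕ}

lemma expect_rollout_succ {n : ℕ} (P : Fin (n + 1) → S → A → PMF S) (π : Policy S A (n + 1))
    (s : S) (f : Episode S A (n + 1) → ℝ) :
    expect (rollout (n + 1) P π s) f = expect (π 0 s) fun a => expect (P 0 s a) fun s' =>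
      expect (rollout n (fun i => P i.succ) (fun i => π i.succ) s') fun x =>
        f (Fin.cons (α := fun _ => S × A × S) (s, a, s') x) := by
  rw [rollout, expect_bind]
  simp only [expect_bind, expect_map]

/-- A bound on conditional expectations given the state and the action at a stage is inherited by
the expectation over the episode. -/
lemma expect_rollout_stage_le {n : ℕ} (P : Fin n → S → A → PMF S) (π : Policy S A n) (s : S)
    (h : Fin n) (F : S × A × S → ℝ) {c : ℝ}
    (hF : ∀ s a, expect (P h s a) (fun s' => F (s, a, s')) ≤ c) :
    expect (rollout n P π s) (fun x => F (x h)) ≤ c := by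
  induction n generalizing s with
  | zero => exact h.elim0
  | succ n ih =>
    rw [expect_rollout_succ]
    refine expect_le _ fun a => ?_
    refine Fin.cases (fun hF => ?_) (fun j hF => ?_) h hF
    · simpa using hF s a
    · refine expect_le _ fun s' => ?_
      simp only [Fin.cons_succ]
      exact ih (fun i => P i.succ) (fun i => π i.succ) s' j hF

/-- A supersolution of the Bellman equation of `π` with rewards `f` dominates the expected total
reward. -/
lemma expect_rollout_sum_le {n : ℕ} (P : Fin n → S → A → PMF S) (π : Policy S A n)
    (f : Fin n → S → A → ℝ) (V : Fin (n + 1) → S → ℝ)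
    (hV : ∀ h s, expect (π h s) (fun a => f h s a + expect (P h s a) (V h.succ)) ≤ V h.castSucc s)
    (h0 : ∀ s, 0 ≤ V (Fin.last n) s) (s : S) :
    expect (rollout n P π s) (fun x => ∑ h, f h (x h).1 (x h).2.1) ≤ V 0 s := by
  induction n generalizing s with
  | zero => simpa using h0 s
  | succ n ih =>
    rw [expect_rollout_succ]
    refine le_trans (expect_mono _ fun a => ?_) (hV 0 s)
    simp only [Fin.sum_univ_succ, Fin.cons_zero, Fin.cons_succ, expect_add, expect_const]
    gcongr
    refine expect_mono _ fun s' => ?_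
    have := ih (fun i => P i.succ) (fun i => π i.succ) (fun i => f i.succ) (fun i => V i.succ)
      (fun h s => hV h.succ s) (fun s => h0 s) s'
    simpa using this

lemma value_eq_expect (mdp : LinearMDP S A d H) (π : Policy S A H) (c : Cost S A H) (s : S) :
    mdp.value π c s = expect (rollout H mdp.P π s) fun x => ∑ h, c h (x h).1 (x h).2.1 := rfl

lemma gap_eq_expect (mdp : LinearMDP S A d H) (π π' : Policy S A H) (c : Cost S A H) :
    mdp.gap π π' c = expect mdp.init (fun s => mdp.value π c s - mdp.value π' c s) := rfl

lemma gap_eq_expect_episodeLaw (mdp : LinearMDP S A d H) (π π' : Policy S A H)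
    (c : Cost S A H) :
    mdp.gap π π' c = expect (mdp.episodeLaw π) (fun x => ∑ h, c h (x h).1 (x h).2.1) -
      expect (mdp.episodeLaw π') (fun x => ∑ h, c h (x h).1 (x h).2.1) := by
  rw [gap_eq_expect, expect_sub, LinearMDP.episodeLaw, LinearMDP.episodeLaw, expect_bind,
    expect_bind]
  rfl

lemma expect_episodeLaw_stage_le (mdp : LinearMDP S A d H) (π : Policy S A H)
    (h : Fin H) (F : S × A × S → ℝ) {c : ℝ}
    (hF : ∀ s a, expect (mdp.P h s a) (fun s' => F (s, a, s')) ≤ c) :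
    expect (mdp.episodeLaw π) (fun x => F (x h)) ≤ c := by
  rw [LinearMDP.episodeLaw, expect_bind]
  exact expect_le _ fun s => expect_rollout_stage_le _ _ _ _ _ hF

/-! ### Exponential supermartingales along the interaction -/

lemma expect_interact_succ (mdp : LinearMDP S A d H) (L : Learner S A H) (n : ℕ)
    (f : (Fin (n + 1) → Episode S A H) → ℝ) :
    expect (mdp.interact L (n + 1)) f = expect (mdp.interact L n) fun hist =>
      expect (mdp.episodeLaw (L n hist)) fun e =>
        f (Fin.snoc (α := fun _ => Episode S A H) hist e) := by
  rw [LinearMDP.interact, expect_bind]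
  simp only [expect_map]

/-- Increments whose conditional exponential moments are at most one have a sum with the same
property. -/
lemma expect_interact_exp_sum_le_one (mdp : LinearMDP S A d H) (L : Learner S A H)
    (g : (j : ℕ) → (Fin j → Episode S A H) → Episode S A H → ℝ)
    (hg : ∀ j hist, expect (mdp.episodeLaw (L j hist)) (fun e => Real.exp (g j hist e)) ≤ 1)
    (K : ℕ) :
    expect (mdp.interact L K)
      (fun run => Real.exp (∑ j : Fin K, g j (past run j) (run j))) ≤ 1 := by
  induction K with
  | zero => simp
  | succ n ih =>
    rw [expect_interact_succ]
    refine le_trans (expect_mono _ fun hist => ?_) ih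
    simp only [Fin.sum_univ_castSucc, past_snoc_castSucc, past_snoc_last, Fin.snoc_castSucc,
      Fin.snoc_last, Real.exp_add, expect_const_mul, Fin.val_castSucc, Fin.val_last]
    exact mul_le_of_le_one_right (Real.exp_pos _).le (hg n hist)

/-- The exponential supermartingale of the Azuma–Hoeffding inequality: the increments `Y j` are
centred by their conditional means. -/
lemma expect_interact_exp_azuma_le_one (mdp : LinearMDP S A d H) (L : Learner S A H)
    (Y : (j : ℕ) → (Fin j → Episode S A H) → Episode S A H → ℝ) {b : ℝ}
    (hY : ∀ j hist e, |Y j hist e - expect (mdp.episodeLaw (L j hist)) (Y j hist)| ≤ b)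
    (t : ℝ) (K : ℕ) :
    expect (mdp.interact L K) (fun run => Real.exp (t *
      (∑ j : Fin K, (Y j (past run j) (run j) -
        expect (mdp.episodeLaw (L j (past run j))) (Y j (past run j)))) -
      K * (t ^ 2 * b ^ 2 / 2))) ≤ 1 := by
  have h := expect_interact_exp_sum_le_one mdp L
    (fun j hist e => t * (Y j hist e - expect (mdp.episodeLaw (L j hist)) (Y j hist)) -
      t ^ 2 * b ^ 2 / 2) (fun j hist => by
        simp only [Real.exp_sub, div_eq_mul_inv (Real.exp _), expect_mul_const]
        rw [← div_eq_mul_inv, div_le_one (Real.exp_pos _)]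
        exact expect_exp_le_of_abs_le _ (hY j hist)
          (by rw [expect_sub, expect_const, sub_self]) t) K
  refine le_trans (le_of_eq ?_) h
  congr 1
  funext run
  simp only [Finset.sum_sub_distrib, mul_sub, Finset.mul_sum, Finset.sum_const, Finset.card_univ,
    Fintype.card_fin, nsmul_eq_mul]

end Rollout

/-! ### The Gram matrix and the elliptical potential -/

lemma abs_dotProduct_le_mul {d : ℕ} {x y : Fin d → ℝ} {b c : ℝ} (hx : ∑ i, |x i| ≤ b) (hc : 0 ≤ c)
    (hy : ∀ i, |y i| ≤ c) : |x ⬝ᵥ y| ≤ b * c :=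
  calc |x ⬝ᵥ y| ≤ ∑ i, |x i * y i| := Finset.abs_sum_le_sum_abs _ _
    _ ≤ ∑ i, |x i| * c := Finset.sum_le_sum fun i _ => by
        rw [abs_mul]; exact mul_le_mul_of_nonneg_left (hy i) (abs_nonneg _)
    _ = (∑ i, |x i|) * c := (Finset.sum_mul _ _ _).symm
    _ ≤ b * c := mul_le_mul_of_nonneg_right hx hc

lemma abs_dotProduct_le_of_l1 {d : ℕ} {x y : Fin d → ℝ} {c : ℝ} (hx : ∑ i, |x i| ≤ 1)
    (hc : 0 ≤ c) (hy : ∀ i, |y i| ≤ c) : |x ⬝ᵥ y| ≤ c :=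
  (abs_dotProduct_le_mul hx hc hy).trans_eq (one_mul c)

lemma dotProduct_self_le_one_of_l1 {d : ℕ} {x : Fin d → ℝ} (hx : ∑ i, |x i| ≤ 1) :
    x ⬝ᵥ x ≤ 1 :=
  (le_abs_self _).trans <| abs_dotProduct_le_of_l1 hx zero_le_one fun i =>
    (Finset.single_le_sum (f := fun i => |x i|) (fun _ _ => abs_nonneg _)
      (Finset.mem_univ i)).trans hx

lemma dotProduct_sq_le {d : ℕ} (x y : Fin d → ℝ) : (x ⬝ᵥ y) ^ 2 ≤ (x ⬝ᵥ x) * (y ⬝ᵥ y) := by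
  have := Finset.sum_mul_sq_le_sq_mul_sq Finset.univ x y
  simpa only [dotProduct, pow_two] using this

lemma dotProduct_self_nonneg' {d : ℕ} (x : Fin d → ℝ) : 0 ≤ x ⬝ᵥ x :=
  Finset.sum_nonneg fun i _ => mul_self_nonneg (x i)

lemma sq_le_dotProduct_self {d : ℕ} (x : Fin d → ℝ) (i : Fin d) : x i ^ 2 ≤ x ⬝ᵥ x := by
  rw [pow_two]
  exact Finset.single_le_sum (f := fun i => x i * x i) (fun _ _ => mul_self_nonneg _)
    (Finset.mem_univ i)

section Gram

variable {S : Type u} {A : Type v} {d k : ℕ} (φ : S → A → Fin d → ℝ) (D : Fin k → S × A × S)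

lemma gram_mulVec (x : Fin d → ℝ) :
    gram φ D *ᵥ x = x + ∑ l, (φ (D l).1 (D l).2.1 ⬝ᵥ x) • φ (D l).1 (D l).2.1 := by
  rw [gram, Matrix.add_mulVec, Matrix.one_mulVec, Matrix.sum_mulVec]
  congr 1
  refine Finset.sum_congr rfl fun l _ => ?_
  rw [Matrix.vecMulVec_mulVec]
  ext i
  simp [mul_comm]

lemma dotProduct_gram_mulVec (x y : Fin d → ℝ) :
    y ⬝ᵥ (gram φ D *ᵥ x) = y ⬝ᵥ x +
      ∑ l, (φ (D l).1 (D l).2.1 ⬝ᵥ x) * (φ (D l).1 (D l).2.1 ⬝ᵥ y) := by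
  rw [gram_mulVec, dotProduct_add, dotProduct_sum]
  congr 1
  exact Finset.sum_congr rfl fun l _ => by
    rw [dotProduct_smul, smul_eq_mul, dotProduct_comm y]

lemma dotProduct_gram_mulVec_self (x : Fin d → ℝ) :
    x ⬝ᵥ (gram φ D *ᵥ x) = x ⬝ᵥ x + ∑ l, (φ (D l).1 (D l).2.1 ⬝ᵥ x) ^ 2 := by
  simp only [dotProduct_gram_mulVec, pow_two]

lemma dotProduct_self_le_gram (x : Fin d → ℝ) : x ⬝ᵥ x ≤ x ⬝ᵥ (gram φ D *ᵥ x) := by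
  rw [dotProduct_gram_mulVec_self]
  exact le_add_of_nonneg_right (Finset.sum_nonneg fun _ _ => sq_nonneg _)

lemma gram_posDef : (gram φ D).PosDef := by
  refine Matrix.PosDef.one.add_posSemidef (Matrix.posSemidef_sum _ fun l _ => ?_)
  simpa using Matrix.posSemidef_vecMulVec_self_star (φ (D l).1 (D l).2.1)

lemma isUnit_det_gram : IsUnit (gram φ D).det := (gram_posDef φ D).det_pos.ne'.isUnit

lemma gram_mulVec_inv_mulVec (y : Fin d → ℝ) : gram φ D *ᵥ ((gram φ D)⁻¹ *ᵥ y) = y := by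
  rw [Matrix.mulVec_mulVec, Matrix.mul_nonsing_inv _ (isUnit_det_gram φ D), Matrix.one_mulVec]

/-- The squared norm `‖y‖²_{Λ⁻¹}` is `‖x‖²_Λ` for the solution `x` of `Λ x = y`. -/
lemma dotProduct_gram_inv_mulVec_self (y : Fin d → ℝ) :
    y ⬝ᵥ ((gram φ D)⁻¹ *ᵥ y) =
      ((gram φ D)⁻¹ *ᵥ y) ⬝ᵥ (gram φ D *ᵥ ((gram φ D)⁻¹ *ᵥ y)) := by
  rw [gram_mulVec_inv_mulVec, dotProduct_comm]

lemma dotProduct_gram_inv_nonneg (y : Fin d → ℝ) : 0 ≤ y ⬝ᵥ ((gram φ D)⁻¹ *ᵥ y) := by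
  rw [dotProduct_gram_inv_mulVec_self]
  exact (dotProduct_self_nonneg' _).trans (dotProduct_self_le_gram φ D _)

lemma gram_inv_mulVec_self_le (y : Fin d → ℝ) :
    ((gram φ D)⁻¹ *ᵥ y) ⬝ᵥ ((gram φ D)⁻¹ *ᵥ y) ≤ y ⬝ᵥ ((gram φ D)⁻¹ *ᵥ y) := by
  rw [dotProduct_gram_inv_mulVec_self]
  exact dotProduct_self_le_gram φ D _

/-- Since `Λ ≥ I`, the norm `‖·‖_{Λ⁻¹}` is at most the Euclidean norm. -/
lemma dotProduct_gram_inv_le (y : Fin d → ℝ) : y ⬝ᵥ ((gram φ D)⁻¹ *ᵥ y) ≤ y ⬝ᵥ y := by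
  set x := (gram φ D)⁻¹ *ᵥ y
  have h1 : x ⬝ᵥ x ≤ y ⬝ᵥ x := gram_inv_mulVec_self_le φ D y
  have h2 := dotProduct_sq_le y x
  have h3 : 0 ≤ y ⬝ᵥ x := dotProduct_gram_inv_nonneg φ D y
  have h4 := dotProduct_self_nonneg' y
  by_contra! h
  nlinarith

lemma abs_gram_inv_apply_le_one (i j : Fin d) : |(gram φ D)⁻¹ i j| ≤ 1 := by
  have h1 := (gram_inv_mulVec_self_le φ D (Pi.single j 1)).trans
    (dotProduct_gram_inv_le φ D (Pi.single j 1))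
  have h2 := (sq_le_dotProduct_self _ i).trans h1
  simp only [Matrix.mulVec_single_one, Matrix.col_apply, single_dotProduct, Pi.single_eq_same,
    one_mul] at h2
  exact (sq_le_one_iff_abs_le_one _).1 h2

variable {φ} in
lemma abs_regress_le (hφ : ∀ s a, ∑ i, |φ s a i| ≤ 1) {V : S → ℝ} {b : ℝ} (hb : 0 ≤ b)
    (hV : ∀ s, |V s| ≤ b) (i : Fin d) : |regress φ D V i| ≤ k * b := by
  set x := regress φ D V with hx
  obtain ⟨m, _, hm⟩ := Finset.exists_max_image Finset.univ (fun i => |x i|) ⟨i, Finset.mem_univ i⟩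
  refine (hm i (Finset.mem_univ i)).trans ?_
  have h1 : x ⬝ᵥ x ≤ (∑ l, V (D l).2.2 • φ (D l).1 (D l).2.1) ⬝ᵥ x := gram_inv_mulVec_self_le φ D _
  have h2 : (∑ l, V (D l).2.2 • φ (D l).1 (D l).2.1) ⬝ᵥ x ≤ k * (b * |x m|) := by
    rw [sum_dotProduct]
    refine (Finset.sum_le_card_nsmul _ _ (b * |x m|) fun l _ => ?_).trans_eq (by simp)
    rw [smul_dotProduct, smul_eq_mul]
    refine (le_abs_self _).trans ?_
    rw [abs_mul]
    exact mul_le_mul (hV _) (abs_dotProduct_le_of_l1 (hφ _ _) (abs_nonneg _)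
      fun i => hm i (Finset.mem_univ i)) (abs_nonneg _) hb
  have h3 := (sq_le_dotProduct_self x m).trans (h1.trans h2)
  rw [← sq_abs] at h3
  rcases (abs_nonneg (x m)).eq_or_lt with h | h
  · rw [← h]; positivity
  · exact le_of_mul_le_mul_right (by nlinarith) h

lemma gram_succ {n : ℕ} (D : Fin (n + 1) → S × A × S) :
    gram φ D = gram φ (fun l : Fin n => D l.castSucc) +
      Matrix.vecMulVec (φ (D (Fin.last n)).1 (D (Fin.last n)).2.1)
        (φ (D (Fin.last n)).1 (D (Fin.last n)).2.1) := by
  rw [gram, gram, Fin.sum_univ_castSucc, add_assoc]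

lemma det_gram_succ {n : ℕ} (D : Fin (n + 1) → S × A × S) :
    (gram φ D).det = (gram φ (fun l : Fin n => D l.castSucc)).det *
      (1 + φ (D (Fin.last n)).1 (D (Fin.last n)).2.1 ⬝ᵥ
        ((gram φ (fun l : Fin n => D l.castSucc))⁻¹ *ᵥ
          φ (D (Fin.last n)).1 (D (Fin.last n)).2.1)) := by
  rw [gram_succ, Matrix.vecMulVec_eq Unit,
    Matrix.det_add_replicateCol_mul_replicateRow (isUnit_det_gram φ _)]
  congr 1
  rw [Matrix.det_unique]
  simp [Matrix.mul_apply, dotProduct, Matrix.mulVec, Matrix.replicateRow, Matrix.replicateCol,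
    Finset.mul_sum, Finset.sum_mul]
  rw [Finset.sum_comm]
  simp only [mul_assoc]

variable {φ}

/-- The elliptical potential lemma. -/
lemma sum_dotProduct_gram_inv_le (hφ : ∀ s a, ∑ i, |φ s a i| ≤ 1) {K : ℕ}
    (D : Fin K → S × A × S) :
    ∑ k : Fin K, φ (D k).1 (D k).2.1 ⬝ᵥ
      ((gram φ (fun l : Fin k => D (Fin.castLE k.isLt.le l)))⁻¹ *ᵥ φ (D k).1 (D k).2.1) ≤
      2 * Real.log (gram φ D).det := by
  induction K with
  | zero => simp [gram]
  | succ n ih =>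
    rw [Fin.sum_univ_castSucc, det_gram_succ]
    set q := φ (D (Fin.last n)).1 (D (Fin.last n)).2.1 ⬝ᵥ
        ((gram φ (fun l : Fin n => D l.castSucc))⁻¹ *ᵥ
          φ (D (Fin.last n)).1 (D (Fin.last n)).2.1) with hq
    have hq0 : 0 ≤ q := dotProduct_gram_inv_nonneg φ _ _
    have hq1 : q ≤ 1 := (dotProduct_gram_inv_le φ _ _).trans
      (dotProduct_self_le_one_of_l1 (hφ _ _))
    have hlog : q ≤ 2 * Real.log (1 + q) := by
      have h1 := Real.one_sub_inv_le_log_of_pos (x := 1 + q) (by linarith)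
      have h2 : q / 2 ≤ 1 - (1 + q)⁻¹ := by
        rw [div_le_iff₀ two_pos, ← sub_nonneg]
        have : (1 - (1 + q)⁻¹) * 2 - q = q * (1 - q) / (1 + q) := by
          field_simp; ring
        rw [this]
        exact div_nonneg (mul_nonneg hq0 (by linarith)) (by linarith)
      linarith
    rw [Real.log_mul (gram_posDef φ _).det_pos.ne' (by linarith), mul_add]
    exact add_le_add (ih fun l => D l.castSucc) hlog

lemma log_det_gram_le (hφ : ∀ s a, ∑ i, |φ s a i| ≤ 1) {K : ℕ}
    (D : Fin K → S × A × S) :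
    Real.log (gram φ D).det ≤ d * Real.log (d * (1 + K)) := by
  have hφ1 : ∀ s a i, |φ s a i| ≤ 1 := fun s a i =>
    (Finset.single_le_sum (f := fun i => |φ s a i|) (fun _ _ => abs_nonneg _)
      (Finset.mem_univ i)).trans (hφ s a)
  have hentry : ∀ i j, |gram φ D i j| ≤ 1 + K := by
    intro i j
    rw [gram, Matrix.add_apply, Matrix.sum_apply]
    refine (abs_add_le _ _).trans (add_le_add ?_ ((Finset.abs_sum_le_sum_abs _ _).trans ?_))
    · rw [Matrix.one_apply]; split_ifs <;> simp
    · refine (Finset.sum_le_card_nsmul _ _ 1 fun l _ => ?_).trans_eq (by simp)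
      rw [Matrix.vecMulVec_apply, abs_mul]
      exact mul_le_one₀ (hφ1 _ _ _) (abs_nonneg _) (hφ1 _ _ _)
  have h1 : |(gram φ D).det| ≤
      (Fintype.card (Fin d)).factorial • ((1 : ℝ) + K) ^ Fintype.card (Fin d) :=
    Matrix.det_le (abv := AbsoluteValue.abs) hentry
  rw [Fintype.card_fin, nsmul_eq_mul] at h1
  have h2 : (d.factorial : ℝ) ≤ (d : ℝ) ^ d := by exact_mod_cast d.factorial_le_pow
  have h3 : (gram φ D).det ≤ ((d : ℝ) * (1 + K)) ^ d := by
    rw [mul_pow]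
    exact (le_abs_self _).trans (h1.trans (mul_le_mul_of_nonneg_right h2 (by positivity)))
  calc _ ≤ Real.log (((d : ℝ) * (1 + K)) ^ d) := Real.log_le_log (gram_posDef φ D).det_pos h3
    _ = _ := Real.log_pow _ _

lemma bonus_nonneg {β : ℝ} (hβ : 0 ≤ β) (s : S) (a : A) : 0 ≤ bonus φ β D s a :=
  mul_nonneg hβ (Real.sqrt_nonneg _)

lemma bonus_le (hφ : ∀ s a, ∑ i, |φ s a i| ≤ 1) {β : ℝ} (hβ : 0 ≤ β) (s : S) (a : A) :
    bonus φ β D s a ≤ β :=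
  mul_le_of_le_one_right hβ (Real.sqrt_le_one.2 ((dotProduct_gram_inv_le φ D _).trans
    (dotProduct_self_le_one_of_l1 (hφ s a))))

/-- Along a sequence of transitions the bonuses add up to `O(β √(d K log))`. -/
lemma sum_bonus_le (hφ : ∀ s a, ∑ i, |φ s a i| ≤ 1) {β : ℝ} (hβ : 0 ≤ β) {K : ℕ}
    (D : Fin K → S × A × S) :
    ∑ k : Fin K, bonus φ β (fun l : Fin k => D (Fin.castLE k.isLt.le l)) (D k).1 (D k).2.1 ≤
      β * √(K * (2 * (d * Real.log (d * (1 + K))))) := by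
  simp only [bonus, ← Finset.mul_sum]
  refine mul_le_mul_of_nonneg_left (Real.le_sqrt_of_sq_le ?_) hβ
  have h := sq_sum_le_card_mul_sum_sq (s := (Finset.univ : Finset (Fin K)))
    (f := fun k => √(φ (D k).1 (D k).2.1 ⬝ᵥ
      ((gram φ (fun l : Fin k => D (Fin.castLE k.isLt.le l)))⁻¹ *ᵥ φ (D k).1 (D k).2.1)))
  simp only [Real.sq_sqrt (dotProduct_gram_inv_nonneg φ _ _), Finset.card_univ,
    Fintype.card_fin] at h
  refine h.trans (mul_le_mul_of_nonneg_left ?_ (Nat.cast_nonneg K))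
  refine (sum_dotProduct_gram_inv_le hφ D).trans ?_
  exact mul_le_mul_of_nonneg_left (log_det_gram_le hφ D) two_pos.le

end Gram

/-! ### The class of optimistic value functions -/

lemma abs_clip_le {r : ℝ} (hr : 0 ≤ r) (x : ℝ) : |clip r x| ≤ r :=
  abs_le.2 ⟨le_max_left _ _, max_le (by linarith) (min_le_left _ _)⟩

lemma abs_clip_sub_clip_le (r x y : ℝ) : |clip r x - clip r y| ≤ |x - y| := by
  unfold clip
  refine (abs_max_sub_max_le_max _ _ _ _).trans ?_
  rw [sub_self, abs_zero]
  refine max_le (abs_nonneg _) ((abs_min_sub_min_le_max _ _ _ _).trans ?_)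
  simp

lemma abs_sqrt_sub_sqrt_le (x y : ℝ) : |√x - √y| ≤ √|x - y| := by
  have key : ∀ x y : ℝ, √x ≤ √y + √|x - y| := fun x y => by
    rw [Real.sqrt_le_left (by positivity)]
    rcases le_or_gt 0 y with hy | hy
    · nlinarith [Real.sq_sqrt hy, Real.sq_sqrt (abs_nonneg (x - y)), le_abs_self (x - y),
        mul_nonneg (Real.sqrt_nonneg y) (Real.sqrt_nonneg |x - y|)]
    · rw [Real.sqrt_eq_zero_of_nonpos hy.le, zero_add, Real.sq_sqrt (abs_nonneg _)]
      linarith [le_abs_self (x - y)]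
  rw [abs_le]
  have h1 := key x y
  have h2 := key y x
  rw [abs_sub_comm] at h2
  constructor <;> linarith

section Class

variable {S : Type u} {A : Type v} {d H : ℕ}

/-- The clipped function `φ(s, a)ᵀ u - β √(φ(s, a)ᵀ Q φ(s, a))`: all action values that the
algorithm computes have this form. -/
def greedyQ (φ : S → A → Fin d → ℝ) (β r : ℝ) (u : Fin d → ℝ) (Q : Matrix (Fin d) (Fin d) ℝ)
    (s : S) (a : A) : ℝ :=
  clip r (φ s a ⬝ᵥ u - β * √(φ s a ⬝ᵥ (Q *ᵥ φ s a)))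

/-- The minimum of `greedyQ` over the actions. -/
def greedyValue (φ : S → A → Fin d → ℝ) (am : (A → ℝ) → A) (β r : ℝ) (u : Fin d → ℝ)
    (Q : Matrix (Fin d) (Fin d) ℝ) (s : S) : ℝ :=
  greedyQ φ β r u Q s (am (greedyQ φ β r u Q s))

lemma abs_greedyValue_le (φ : S → A → Fin d → ℝ) (am : (A → ℝ) → A) (β : ℝ) {r : ℝ}
    (hr : 0 ≤ r) (u : Fin d → ℝ) (Q : Matrix (Fin d) (Fin d) ℝ) (s : S) :
    |greedyValue φ am β r u Q s| ≤ r := abs_clip_le hr _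

/-- Taking minima is `1`-Lipschitz for the supremum norm. -/
lemma abs_argmin_sub_argmin_le {am : (A → ℝ) → A} (ham : ∀ (q : A → ℝ) (a : A), q (am q) ≤ q a)
    {q q' : A → ℝ} {γ : ℝ} (h : ∀ a, |q a - q' a| ≤ γ) : |q (am q) - q' (am q')| ≤ γ := by
  have h1 := ham q (am q')
  have h2 := ham q' (am q)
  have h3 := abs_le.1 (h (am q))
  have h4 := abs_le.1 (h (am q'))
  rw [abs_le]
  constructor <;> linarith

lemma abs_greedyValue_sub_le {φ : S → A → Fin d → ℝ} (hφ : ∀ s a, ∑ i, |φ s a i| ≤ 1)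
    {am : (A → ℝ) → A} (ham : ∀ (q : A → ℝ) (a : A), q (am q) ≤ q a) {β : ℝ} (hβ : 0 ≤ β) (r : ℝ)
    {u u' : Fin d → ℝ} {Q Q' : Matrix (Fin d) (Fin d) ℝ} {η : ℝ} (hη : 0 ≤ η)
    (hu : ∀ i, |u i - u' i| ≤ η) (hQ : ∀ i j, |Q i j - Q' i j| ≤ η) (s : S) :
    |greedyValue φ am β r u Q s - greedyValue φ am β r u' Q' s| ≤ η + β * √η := by
  refine abs_argmin_sub_argmin_le ham
    (q := greedyQ φ β r u Q s) (q' := greedyQ φ β r u' Q' s) fun a => ?_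
  refine (abs_clip_sub_clip_le _ _ _).trans ?_
  have h1 : |φ s a ⬝ᵥ u - φ s a ⬝ᵥ u'| ≤ η := by
    rw [← dotProduct_sub]
    exact abs_dotProduct_le_of_l1 (hφ s a) hη hu
  have h2 : |φ s a ⬝ᵥ (Q *ᵥ φ s a) - φ s a ⬝ᵥ (Q' *ᵥ φ s a)| ≤ η := by
    rw [← dotProduct_sub, ← Matrix.sub_mulVec]
    refine abs_dotProduct_le_of_l1 (hφ s a) hη fun i => ?_
    rw [Matrix.mulVec, dotProduct_comm]
    exact abs_dotProduct_le_of_l1 (hφ s a) hη fun j => hQ i j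
  have h3 : |√(φ s a ⬝ᵥ (Q *ᵥ φ s a)) - √(φ s a ⬝ᵥ (Q' *ᵥ φ s a))| ≤ √η :=
    (abs_sqrt_sub_sqrt_le _ _).trans (Real.sqrt_le_sqrt h2)
  calc _ = |(φ s a ⬝ᵥ u - φ s a ⬝ᵥ u') -
        β * (√(φ s a ⬝ᵥ (Q *ᵥ φ s a)) - √(φ s a ⬝ᵥ (Q' *ᵥ φ s a)))| := by congr 1; ring
    _ ≤ _ := by
      refine (abs_sub _ _).trans (add_le_add h1 ?_)
      rw [abs_mul, abs_of_nonneg hβ]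
      exact mul_le_mul_of_nonneg_left h3 hβ

variable (φ : S → A → Fin d → ℝ) (am : (A → ℝ) → A) (β : ℝ) (w : Fin H → Fin d → ℝ) {k : ℕ}
  (hist : Fin k → Episode S A H)

lemma lsviV_last (s : S) : lsviV φ am β w hist (Fin.last H) s = 0 := by
  simp [lsviV]

lemma lsviV_castSucc (h : Fin H) (s : S) :
    lsviV φ am β w hist h.castSucc s =
      lsviQ φ am β w hist h s (am (lsviQ φ am β w hist h s)) := by
  simp only [lsviV, lsviQ, Fin.reverseInduction_castSucc]

lemma abs_lsviV_le (i : Fin (H + 1)) (s : S) :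
    |lsviV φ am β w hist i s| ≤ (H : ℝ) - (i : ℕ) := by
  induction i using Fin.lastCases with
  | last => simp [lsviV_last]
  | cast h =>
    rw [lsviV_castSucc]
    refine abs_clip_le ?_ _
    have : ((h : ℕ) : ℝ) ≤ H := by exact_mod_cast h.isLt.le
    linarith

lemma abs_lsviV_le_horizon (i : Fin (H + 1)) (s : S) : |lsviV φ am β w hist i s| ≤ H :=
  (abs_lsviV_le φ am β w hist i s).trans (by simp)

/-- The values of the next stage belong to the class, with bounded parameters. At the last stage
the clipping level is zero, so that the class contains the zero function only. -/
lemma exists_lsviV_succ_eq_greedyValue (hφ : ∀ s a, ∑ i, |φ s a i| ≤ 1)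
    (hw : ∀ h i, |w h i| ≤ 1) (h : Fin H) :
    ∃ (u : Fin d → ℝ) (Q : Matrix (Fin d) (Fin d) ℝ), (∀ i, |u i| ≤ 1 + k * H) ∧
      (∀ i j, |Q i j| ≤ 1) ∧
      lsviV φ am β w hist h.succ = greedyValue φ am β ((H : ℝ) - ((h : ℕ) + 1)) u Q := by
  rcases Fin.eq_castSucc_or_eq_last h.succ with ⟨h', hh⟩ | hh
  · refine ⟨w h' + regress φ (fun l => hist l h') (lsviV φ am β w hist h'.succ),
      (gram φ (fun l => hist l h'))⁻¹, fun i => ?_,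
      fun i j => abs_gram_inv_apply_le_one φ _ i j, ?_⟩
    · exact (abs_add_le _ _).trans (add_le_add (hw _ _) (abs_regress_le _ hφ (Nat.cast_nonneg H)
        (abs_lsviV_le_horizon φ am β w hist _) i))
    · have hr : (H : ℝ) - ((h : ℕ) + 1) = (H : ℝ) - (h' : ℕ) := by
        have := congrArg Fin.val hh
        simp only [Fin.val_succ, Fin.val_castSucc] at this
        rw [← this]; push_cast; ring
      funext s
      have hQ : lsviQ φ am β w hist h' s = greedyQ φ β ((H : ℝ) - (h' : ℕ))
          (w h' + regress φ (fun l => hist l h') (lsviV φ am β w hist h'.succ))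
          (gram φ (fun l => hist l h'))⁻¹ s := by
        funext a
        simp only [lsviQ, greedyQ, lsviStep, bonus, dotProduct_add]
      rw [hh, lsviV_castSucc, hr, greedyValue, hQ]
  · have hr : (H : ℝ) - ((h : ℕ) + 1) = 0 := by
      have := congrArg Fin.val hh
      simp only [Fin.val_succ, Fin.val_last] at this
      have h1 : ((h : ℕ) : ℝ) + 1 = H := by exact_mod_cast this
      linarith
    refine ⟨0, 0, fun i => by simp; positivity, fun i j => by simp, ?_⟩
    funext s
    rw [hh, lsviV_last, hr]
    simp [greedyValue, greedyQ, clip]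

end Class

/-! ### Self-normalised concentration, uniformly over a grid -/

/-- The points `-m/n, …, m/n` of the grid of mesh `1/n`. -/
def gridPoint (m n : ℕ) (j : Fin (2 * m + 1)) : ℝ := ((j : ℕ) - m) / n

lemma exists_gridPoint {n R : ℕ} (hn : 0 < n) {x : ℝ} (hx : |x| ≤ R) :
    ∃ j : Fin (2 * (n * R) + 1), |x - gridPoint (n * R) n j| ≤ 1 / n := by
  have hn' : (0 : ℝ) < n := Nat.cast_pos.2 hn
  obtain ⟨h1, h2⟩ := abs_le.1 hx
  have h0 : 0 ≤ x * n + n * R := by nlinarith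
  have hlt : ⌊x * n + n * R⌋₊ < 2 * (n * R) + 1 := by
    rw [Nat.floor_lt h0]; push_cast; nlinarith
  refine ⟨⟨_, hlt⟩, ?_⟩
  have h3 := Nat.floor_le h0
  have h4 := Nat.lt_floor_add_one (x * n + n * R)
  have e : x - gridPoint (n * R) n ⟨_, hlt⟩ = (x * n + n * R - ⌊x * n + n * R⌋₊) / n := by
    simp only [gridPoint]; push_cast; field_simp; ring
  rw [e, abs_of_nonneg (div_nonneg (by linarith) hn'.le)]
  gcongr
  linarith

/-- Grid indices of a direction `θ` and of the parameters `u`, `Q` of a value function. -/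
abbrev GridIndex (d m : ℕ) : Type :=
  (Fin d → Fin (2 * m + 1)) × (Fin d → Fin (2 * m + 1)) × (Fin d → Fin d → Fin (2 * m + 1))

section Concentration

variable {S : Type u} {A : Type v} [Fintype S] {d H : ℕ}

/-- The one step prediction error `V(s') - E V` of a transition. -/
def noise (mdp : LinearMDP S A d H) (h : Fin H) (V : S → ℝ) (t : S × A × S) : ℝ :=
  V t.2.2 - expect (mdp.P h t.1 t.2.1) V

lemma abs_noise_le (mdp : LinearMDP S A d H) (h : Fin H) {V : S → ℝ} {b : ℝ}
    (hV : ∀ s, |V s| ≤ b) (t : S × A × S) : |noise mdp h V t| ≤ 2 * b := by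
  have := (abs_sub (V t.2.2) _).trans
    (add_le_add (hV t.2.2) (abs_expect_le (mdp.P h t.1 t.2.1) hV))
  rw [two_mul]; exact this

lemma noise_sub (mdp : LinearMDP S A d H) (h : Fin H) (V V' : S → ℝ) (t : S × A × S) :
    noise mdp h V t - noise mdp h V' t = noise mdp h (fun s => V s - V' s) t := by
  simp only [noise, expect_sub]; ring

/-- The exponent contributed by one transition to the self-normalised supermartingale. -/
def confIncrement (mdp : LinearMDP S A d H) (h : Fin H) (V : S → ℝ) (θ : Fin d → ℝ)
    (t : S × A × S) : ℝ :=
  (mdp.φ t.1 t.2.1 ⬝ᵥ θ) * noise mdp h V t - 2 * (H : ℝ) ^ 2 * (mdp.φ t.1 t.2.1 ⬝ᵥ θ) ^ 2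

lemma expect_exp_confIncrement_le_one (mdp : LinearMDP S A d H) (h : Fin H) {V : S → ℝ}
    (hV : ∀ s, |V s| ≤ H) (θ : Fin d → ℝ) (s : S) (a : A) :
    expect (mdp.P h s a) (fun s' => Real.exp (confIncrement mdp h V θ (s, a, s'))) ≤ 1 := by
  simp only [confIncrement, Real.exp_sub, div_eq_mul_inv (Real.exp _), expect_mul_const]
  rw [← div_eq_mul_inv, div_le_one (Real.exp_pos _)]
  refine (expect_exp_le_of_abs_le _ (b := 2 * (H : ℝ)) (fun s' => abs_noise_le mdp h hV _) ?_
    _).trans_eq ?_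
  · simp only [noise]; rw [expect_sub, expect_const, sub_self]
  · congr 1; ring

lemma sum_ite_lt_eq_sum_past {S : Type u} {A : Type v} {H K : ℕ}
    (run : Fin K → Episode S A H) (k : Fin K) (f : Episode S A H → ℝ) :
    ∑ j : Fin K, (if (j : ℕ) < k then f (run j) else 0) = ∑ l, f (past run k l) := by
  rw [← Finset.sum_filter]
  symm
  refine Finset.sum_bij (fun l _ => Fin.castLE k.isLt.le l) ?_ ?_ ?_ ?_
  · intro l _
    simp only [Finset.mem_filter, Finset.mem_univ, true_and]
    exact l.isLt
  · intro l _ l' _ hl; exact Fin.castLE_injective _ hl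
  · intro j hj
    simp only [Finset.mem_filter, Finset.mem_univ, true_and] at hj
    exact ⟨⟨j, hj⟩, Finset.mem_univ _, rfl⟩
  · intro l _; rfl

lemma expect_interact_exp_conf_le_one [Fintype A] (mdp : LinearMDP S A d H) (L : Learner S A H)
    {K : ℕ} (k : Fin K) (h : Fin H) {V : S → ℝ} (hV : ∀ s, |V s| ≤ H) (θ : Fin d → ℝ) :
    expect (mdp.interact L K) (fun run =>
      Real.exp (∑ l, confIncrement mdp h V θ (past run k l h))) ≤ 1 := by
  have := expect_interact_exp_sum_le_one mdp L
    (fun j _ e => if j < (k : ℕ) then confIncrement mdp h V θ (e h) else 0) (fun j hist => by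
      by_cases hj : j < (k : ℕ)
      · simp only [hj, if_true]
        exact expect_episodeLaw_stage_le mdp _ h
          (fun t => Real.exp (confIncrement mdp h V θ t))
          (expect_exp_confIncrement_le_one mdp h hV θ)
      · simp [hj]) K
  simpa only [sum_ite_lt_eq_sum_past _ k (fun e => confIncrement mdp h V θ (e h))] using this

/-- The value function that belongs to a grid index, at the stage after `h`. -/
def gridValue (mdp : LinearMDP S A d H) (am : (A → ℝ) → A) (β : ℝ) (m n : ℕ) (h : Fin H)
    (p : GridIndex d m) : S → ℝ :=
  greedyValue mdp.φ am β ((H : ℝ) - ((h : ℕ) + 1)) (fun i => gridPoint m n (p.2.1 i))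
    (Matrix.of fun i j => gridPoint m n (p.2.2 i j))

/-- The average, over all episodes, stages and grid points, of the self-normalised exponential
supermartingales; the directions are scaled by `t`. -/
def confWeight (mdp : LinearMDP S A d H) (am : (A → ℝ) → A) (β t : ℝ) (m n : ℕ) {K : ℕ}
    (run : Fin K → Episode S A H) : ℝ :=
  (Fintype.card (Fin K × Fin H × GridIndex d m) : ℝ)⁻¹ *
    ∑ q : Fin K × Fin H × GridIndex d m, Real.exp (∑ l, confIncrement mdp q.2.1
      (gridValue mdp am β m n q.2.1 q.2.2) (fun i => t * gridPoint m n (q.2.2.1 i))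
        (past run q.1 l q.2.1))

lemma confWeight_nonneg (mdp : LinearMDP S A d H) (am : (A → ℝ) → A) (β t : ℝ) (m n : ℕ) {K : ℕ}
    (run : Fin K → Episode S A H) : 0 ≤ confWeight mdp am β t m n run :=
  mul_nonneg (by positivity) (Finset.sum_nonneg fun _ _ => (Real.exp_pos _).le)

lemma horizon_sub_nonneg (h : Fin H) : 0 ≤ (H : ℝ) - ((h : ℕ) + 1) := by
  have : ((h : ℕ) : ℝ) + 1 ≤ H := by exact_mod_cast h.isLt
  linarith

lemma abs_gridValue_le (mdp : LinearMDP S A d H) (am : (A → ℝ) → A) (β : ℝ) (m n : ℕ) (h : Fin H)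
    (p : GridIndex d m) (s : S) : |gridValue mdp am β m n h p s| ≤ H :=
  (abs_greedyValue_le _ _ _ (horizon_sub_nonneg h) _ _ _).trans
    (sub_le_self _ (by positivity))

lemma expect_confWeight_le_one [Fintype A] (mdp : LinearMDP S A d H) (am : (A → ℝ) → A)
    (β t : ℝ) (m n : ℕ) (L : Learner S A H) (K : ℕ) :
    expect (mdp.interact L K) (confWeight mdp am β t m n) ≤ 1 := by
  unfold confWeight
  rw [expect_const_mul, expect_sum]
  refine (mul_le_mul_of_nonneg_left (Finset.sum_le_card_nsmul _ _ 1 fun q _ =>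
    expect_interact_exp_conf_le_one mdp L q.1 q.2.1 (abs_gridValue_le mdp am β m n _ _) _)
    (by positivity)).trans ?_
  rw [nsmul_eq_mul, mul_one, Finset.card_univ]
  exact inv_mul_le_one

lemma sum_confIncrement_le_of_confWeight_lt {mdp : LinearMDP S A d H} {am : (A → ℝ) → A}
    {β t b T : ℝ} {m n K : ℕ} {run : Fin K → Episode S A H}
    (hrun : confWeight mdp am β t m n run < b)
    (hT : (Fintype.card (Fin K × Fin H × GridIndex d m) : ℝ) * b ≤ Real.exp T)
    (k : Fin K) (h : Fin H) (p : GridIndex d m) :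
    ∑ l, confIncrement mdp h (gridValue mdp am β m n h p) (fun i => t * gridPoint m n (p.1 i))
      (past run k l h) ≤ T := by
  have hcard : (0 : ℝ) < Fintype.card (Fin K × Fin H × GridIndex d m) :=
    Nat.cast_pos.2 (Fintype.card_pos_iff.2 ⟨(k, h, p)⟩)
  rw [confWeight, inv_mul_lt_iff₀ hcard] at hrun
  refine Real.exp_le_exp.1 (le_trans ?_ (hrun.le.trans hT))
  exact Finset.single_le_sum (f := fun q : Fin K × Fin H × GridIndex d m =>
    Real.exp (∑ l, confIncrement mdp q.2.1
      (gridValue mdp am β m n q.2.1 q.2.2) (fun i => t * gridPoint m n (q.2.2.1 i))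
        (past run q.1 l q.2.1))) (fun _ _ => (Real.exp_pos _).le) (Finset.mem_univ (k, h, p))

end Concentration

section Confidence

variable {S : Type u} {A : Type v} [Fintype S] {d H : ℕ}

/-- If the supermartingale of a nearby grid direction `θ` and a nearby value function `V'` is
bounded, then the noise in the direction `x` of the unit ball of `‖·‖_Λ` is small. -/
lemma sum_dotProduct_mul_noise_le (mdp : LinearMDP S A d H) (hH : 1 ≤ H) (h : Fin H) {k : ℕ}
    (D : Fin k → S × A × S) {V V' : S → ℝ} (hV' : ∀ s, |V' s| ≤ H) {γ η τ : ℝ}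
    (hVV : ∀ s, |V s - V' s| ≤ γ) {x θ : Fin d → ℝ} (hx : x ⬝ᵥ (gram mdp.φ D *ᵥ x) ≤ 1)
    (hη : 0 ≤ η) (hθ : ∀ i, |x i - θ i| ≤ η) (hτ : 1 ≤ τ)
    (hsum : ∑ l, confIncrement mdp h V' (fun i => τ / H * θ i) (D l) ≤ τ ^ 2)
    (h1 : k * η ^ 2 ≤ 1) (h2 : k * (H * η) ≤ 1) (h3 : k * γ ≤ 1) :
    ∑ l, (mdp.φ (D l).1 (D l).2.1 ⬝ᵥ x) * noise mdp h V (D l) ≤ 13 * (H * τ) := by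
  have hH' : (1 : ℝ) ≤ H := by exact_mod_cast hH
  have hH0 : (0 : ℝ) < H := by linarith
  set a : Fin k → ℝ := fun l => mdp.φ (D l).1 (D l).2.1 ⬝ᵥ x with ha
  set b : Fin k → ℝ := fun l => mdp.φ (D l).1 (D l).2.1 ⬝ᵥ θ with hb
  have hab : ∀ l, |a l - b l| ≤ η := fun l => by
    rw [ha, hb]; simp only; rw [← dotProduct_sub]
    exact abs_dotProduct_le_of_l1 (mdp.feature_norm _ _) hη hθ
  have hsq : ∑ l, a l ^ 2 ≤ 1 := by
    rw [dotProduct_gram_mulVec_self] at hx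
    linarith [dotProduct_self_nonneg' x]
  have ha1 : ∀ l, |a l| ≤ 1 := fun l => by
    rw [← sq_le_one_iff_abs_le_one]
    exact (Finset.single_le_sum (f := fun l => a l ^ 2) (fun _ _ => sq_nonneg _)
      (Finset.mem_univ l)).trans hsq
  have hbsq : ∑ l, b l ^ 2 ≤ 4 := by
    have : ∑ l, b l ^ 2 ≤ ∑ l : Fin k, (2 * a l ^ 2 + 2 * η ^ 2) :=
      Finset.sum_le_sum fun l _ => by
        have := sq_le_sq.2 ((hab l).trans (le_abs_self η))
        nlinarith [sq_nonneg (2 * a l - b l)]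
    rw [Finset.sum_add_distrib, ← Finset.mul_sum, Finset.sum_const, Finset.card_univ,
      Fintype.card_fin, nsmul_eq_mul] at this
    linarith
  have hgrid : ∑ l, b l * noise mdp h V' (D l) ≤ 9 * (H * τ) := by
    have e : ∑ l, confIncrement mdp h V' (fun i => τ / H * θ i) (D l) =
        τ / H * ∑ l, b l * noise mdp h V' (D l) - 2 * τ ^ 2 * ∑ l, b l ^ 2 := by
      rw [Finset.mul_sum, Finset.mul_sum, ← Finset.sum_sub_distrib]
      refine Finset.sum_congr rfl fun l _ => ?_
      have e1 : (fun i => τ / H * θ i) = (τ / H) • θ := rfl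
      rw [confIncrement, e1, dotProduct_smul, smul_eq_mul]
      change τ / H * b l * _ - 2 * (H : ℝ) ^ 2 * (τ / H * b l) ^ 2 = _
      field_simp
    rw [e] at hsum
    have hle : τ / H * ∑ l, b l * noise mdp h V' (D l) ≤ 9 * τ ^ 2 := by
      nlinarith [sq_nonneg τ]
    rw [div_mul_eq_mul_div, div_le_iff₀ hH0] at hle
    have : τ * ∑ l, b l * noise mdp h V' (D l) ≤ τ * (9 * (H * τ)) := by linarith
    exact le_of_mul_le_mul_left this (by linarith)
  have hterm : ∀ l, a l * noise mdp h V (D l) ≤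
      b l * noise mdp h V' (D l) + (2 * (H * η) + 2 * γ) := fun l => by
    have e : a l * noise mdp h V (D l) = b l * noise mdp h V' (D l) +
        ((a l - b l) * noise mdp h V' (D l) +
          a l * noise mdp h (fun s => V s - V' s) (D l)) := by
      rw [← noise_sub]; ring
    rw [e]
    refine add_le_add le_rfl (add_le_add ?_ ?_)
    · refine (le_abs_self _).trans ?_
      rw [abs_mul]
      calc _ ≤ η * (2 * H) := mul_le_mul (hab l) (abs_noise_le mdp h hV' _) (abs_nonneg _) hη
        _ = _ := by ring
    · refine (le_abs_self _).trans ?_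
      rw [abs_mul]
      calc _ ≤ 1 * (2 * γ) := mul_le_mul (ha1 l) (abs_noise_le mdp h hVV _) (abs_nonneg _)
            zero_le_one
        _ = _ := by ring
  have hfin := Finset.sum_le_sum fun l (_ : l ∈ Finset.univ) => hterm l
  rw [Finset.sum_add_distrib, Finset.sum_const, Finset.card_univ,
      Fintype.card_fin, nsmul_eq_mul] at hfin
  nlinarith

/-- The one step expectation of any function is linear in the features. -/
lemma expect_transition_eq (mdp : LinearMDP S A d H) (h : Fin H) (V : S → ℝ) (s : S) (a : A) :
    expect (mdp.P h s a) V = mdp.φ s a ⬝ᵥ fun i => ∑ s', mdp.M h i s' * V s' := by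
  simp only [expect, mdp.factor, dotProduct, Finset.sum_mul, Finset.mul_sum]
  rw [Finset.sum_comm]
  exact Finset.sum_congr rfl fun i _ => Finset.sum_congr rfl fun s' _ => mul_assoc _ _ _

lemma abs_sum_factor_mul_le (mdp : LinearMDP S A d H) (h : Fin H) {V : S → ℝ} {b : ℝ}
    (hb : 0 ≤ b) (hV : ∀ s, |V s| ≤ b) (i : Fin d) : |∑ s', mdp.M h i s' * V s'| ≤ b :=
  calc |∑ s', mdp.M h i s' * V s'| ≤ ∑ s', |mdp.M h i s' * V s'| := Finset.abs_sum_le_sum_abs _ _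
    _ ≤ ∑ s', |mdp.M h i s'| * b := Finset.sum_le_sum fun s' _ => by
        rw [abs_mul]; exact mul_le_mul_of_nonneg_left (hV s') (abs_nonneg _)
    _ = (∑ s', |mdp.M h i s'|) * b := (Finset.sum_mul _ _ _).symm
    _ ≤ b := mul_le_of_le_one_left hb (mdp.factor_norm h i)

/-- The error of ridge regression: the noise and the bias of the regularisation, both tested
against `x = Λ⁻¹ φ(s, a)`. -/
lemma dotProduct_regress_sub_expect (mdp : LinearMDP S A d H) (h : Fin H) {k : ℕ}
    (D : Fin k → S × A × S) (V : S → ℝ) (s : S) (a : A) :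
    mdp.φ s a ⬝ᵥ regress mdp.φ D V - expect (mdp.P h s a) V =
      ∑ l, (mdp.φ (D l).1 (D l).2.1 ⬝ᵥ ((gram mdp.φ D)⁻¹ *ᵥ mdp.φ s a)) * noise mdp h V (D l) -
        ((gram mdp.φ D)⁻¹ *ᵥ mdp.φ s a) ⬝ᵥ fun i => ∑ s', mdp.M h i s' * V s' := by
  set x := (gram mdp.φ D)⁻¹ *ᵥ mdp.φ s a with hx
  set θ : Fin d → ℝ := fun i => ∑ s', mdp.M h i s' * V s' with hθ
  have hφ : mdp.φ s a = gram mdp.φ D *ᵥ x := (gram_mulVec_inv_mulVec _ _ _).symm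
  have hsymm : ∀ y : Fin d → ℝ, mdp.φ s a ⬝ᵥ y = x ⬝ᵥ (gram mdp.φ D *ᵥ y) := fun y => by
    rw [hφ, dotProduct_comm, dotProduct_gram_mulVec, dotProduct_gram_mulVec, dotProduct_comm]
    simp only [mul_comm]
  have h1 : mdp.φ s a ⬝ᵥ regress mdp.φ D V =
      ∑ l, (mdp.φ (D l).1 (D l).2.1 ⬝ᵥ x) * V (D l).2.2 := by
    rw [hsymm, regress, gram_mulVec_inv_mulVec, dotProduct_sum]
    exact Finset.sum_congr rfl fun l _ => by
      rw [dotProduct_smul, smul_eq_mul, dotProduct_comm, mul_comm]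
  rw [h1, expect_transition_eq, ← hθ, hsymm, dotProduct_gram_mulVec]
  simp only [noise, expect_transition_eq, ← hθ, mul_sub, Finset.sum_sub_distrib]
  simp only [mul_comm (_ ⬝ᵥ θ)]
  ring

/-- The regression error is at most the bonus, provided that the supermartingales of all grid
points are bounded. -/
lemma abs_dotProduct_regress_sub_expect_le (mdp : LinearMDP S A d H) (hH : 1 ≤ H)
    {am : (A → ℝ) → A} (ham : ∀ (q : A → ℝ) (a : A), q (am q) ≤ q a) (h : Fin H) {n R k : ℕ}
    {τ : ℝ} (hτ : 1 ≤ τ) (hd : (d : ℝ) ≤ τ ^ 2) (hn : 0 < n) (hR : 1 + k * H ≤ R)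
    (hkn : (k : ℝ) * (H / n + 14 * (H * τ) * √(1 / n)) ≤ 1)
    (hist : Fin k → Episode S A H)
    (hconf : ∀ p : GridIndex d (n * R), ∑ l, confIncrement mdp h
      (gridValue mdp am (14 * (H * τ)) (n * R) n h p)
      (fun i => τ / H * gridPoint (n * R) n (p.1 i)) (hist l h) ≤ τ ^ 2)
    {w : Fin H → Fin d → ℝ} (hw : ∀ h i, |w h i| ≤ 1) (s : S) (a : A) :
    |mdp.φ s a ⬝ᵥ regress mdp.φ (fun l => hist l h)
        (lsviV mdp.φ am (14 * (H * τ)) w hist h.succ) -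
      expect (mdp.P h s a) (lsviV mdp.φ am (14 * (H * τ)) w hist h.succ)| ≤
      bonus mdp.φ (14 * (H * τ)) (fun l => hist l h) s a := by
  have hH' : (1 : ℝ) ≤ H := by exact_mod_cast hH
  have hn' : (1 : ℝ) ≤ n := by exact_mod_cast hn
  have hR' : 1 + (k : ℝ) * H ≤ R := by exact_mod_cast hR
  have hη0 : (0 : ℝ) ≤ 1 / n := by positivity
  have hη1 : (1 : ℝ) / n ≤ 1 := by rw [div_le_one (by linarith)]; exact hn'
  have hβ0 : 0 ≤ 14 * (H * τ) := by positivity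
  set D : Fin k → S × A × S := fun l => hist l h with hD
  set V := lsviV mdp.φ am (14 * (H * τ)) w hist h.succ with hV
  have hVH : ∀ s, |V s| ≤ H := abs_lsviV_le_horizon _ _ _ _ _ _
  obtain ⟨u, Q, hu, hQ, hVu⟩ := exists_lsviV_succ_eq_greedyValue mdp.φ am (14 * (H * τ)) w hist
    mdp.feature_norm hw h
  have hone : (1 : ℝ) ≤ R := le_trans (le_add_of_nonneg_right (by positivity)) hR'
  choose ju hju using fun i => exists_gridPoint hn ((hu i).trans hR')
  choose jQ hjQ using fun i j => exists_gridPoint hn ((hQ i j).trans hone)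
  -- the noise in every direction of the unit ball of `‖·‖_Λ`
  have hunit : ∀ x : Fin d → ℝ, x ⬝ᵥ (gram mdp.φ D *ᵥ x) ≤ 1 →
      ∑ l, (mdp.φ (D l).1 (D l).2.1 ⬝ᵥ x) * noise mdp h V (D l) ≤ 13 * (H * τ) := by
    intro x hx
    have hxi : ∀ i, |x i| ≤ 1 := fun i => (sq_le_one_iff_abs_le_one _).1
      ((sq_le_dotProduct_self x i).trans ((dotProduct_self_le_gram mdp.φ D x).trans hx))
    choose jx hjx using fun i => exists_gridPoint hn ((hxi i).trans hone)
    refine sum_dotProduct_mul_noise_le mdp hH h D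
      (abs_gridValue_le mdp am (14 * (H * τ)) (n * R) n h (jx, ju, jQ))
      (γ := 1 / n + 14 * (H * τ) * √(1 / n)) ?_ hx hη0 hjx hτ
      (hconf (jx, ju, jQ)) ?_ ?_ ?_
    · intro s
      rw [hV, hVu]
      exact abs_greedyValue_sub_le mdp.feature_norm ham hβ0 _ hη0 hju hjQ s
    all_goals refine le_trans (mul_le_mul_of_nonneg_left ?_ (Nat.cast_nonneg k)) hkn
    · refine le_trans ?_ (le_add_of_nonneg_right (by positivity))
      calc (1 / (n : ℝ)) ^ 2 ≤ 1 / n := by nlinarith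
        _ ≤ H / n := by gcongr
    · rw [mul_one_div]
      exact le_add_of_nonneg_right (by positivity)
    · gcongr
  rw [dotProduct_regress_sub_expect, bonus]
  set x := (gram mdp.φ D)⁻¹ *ᵥ mdp.φ s a with hx
  set q := mdp.φ s a ⬝ᵥ x with hq
  have hq0 : 0 ≤ q := dotProduct_gram_inv_nonneg _ _ _
  have hxq : x ⬝ᵥ (gram mdp.φ D *ᵥ x) = q := (dotProduct_gram_inv_mulVec_self _ _ _).symm
  have hxx : x ⬝ᵥ x ≤ q := gram_inv_mulVec_self_le _ _ _
  set N : (Fin d → ℝ) → ℝ := fun y =>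
    ∑ l, (mdp.φ (D l).1 (D l).2.1 ⬝ᵥ y) * noise mdp h V (D l) with hN
  have hNsmul : ∀ (c : ℝ) y, N (c • y) = c * N y := fun c y => by
    simp only [hN, dotProduct_smul, smul_eq_mul, Finset.mul_sum, mul_assoc]
  have hnoise : |N x| ≤ 13 * (H * τ) * √q := by
    rcases hq0.eq_or_lt with h0 | hpos
    · have : x = 0 := dotProduct_self_eq_zero.1
        (le_antisymm (hxx.trans h0.symm.le) (dotProduct_self_nonneg' x))
      simp [hN, this, ← h0]
    · have hs : 0 < √q := Real.sqrt_pos.2 hpos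
      have hscale : ∀ c : ℝ, c ^ 2 = q⁻¹ → (c • x) ⬝ᵥ (gram mdp.φ D *ᵥ (c • x)) ≤ 1 := by
        intro c hc
        rw [Matrix.mulVec_smul, smul_dotProduct, dotProduct_smul, hxq, smul_eq_mul, smul_eq_mul,
          ← mul_assoc, ← pow_two, hc, inv_mul_cancel₀ hpos.ne']
      have e1 := hunit ((√q)⁻¹ • x) (hscale _ (by rw [inv_pow, Real.sq_sqrt hq0]))
      have e2 := hunit (-(√q)⁻¹ • x) (hscale _ (by rw [neg_sq, inv_pow, Real.sq_sqrt hq0]))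
      change N _ ≤ _ at e1 e2
      rw [hNsmul] at e1 e2
      rw [inv_mul_le_iff₀ hs] at e1
      rw [neg_mul, ← mul_neg, inv_mul_le_iff₀ hs] at e2
      rw [abs_le]; constructor <;> linarith
  have hbias : |x ⬝ᵥ fun i => ∑ s', mdp.M h i s' * V s'| ≤ H * τ * √q := by
    rw [← Real.sqrt_sq (show 0 ≤ H * τ by positivity), ← Real.sqrt_mul (sq_nonneg _)]
    refine Real.abs_le_sqrt ((dotProduct_sq_le _ _).trans ?_)
    have hθ : (fun i => ∑ s', mdp.M h i s' * V s') ⬝ᵥ (fun i => ∑ s', mdp.M h i s' * V s') ≤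
        d * (H : ℝ) ^ 2 := by
      refine (Finset.sum_le_card_nsmul _ _ ((H : ℝ) ^ 2) fun i _ => ?_).trans_eq (by simp)
      rw [← pow_two]
      exact sq_le_sq' (abs_le.1 (abs_sum_factor_mul_le mdp h (Nat.cast_nonneg H) hVH i)).1
        (abs_le.1 (abs_sum_factor_mul_le mdp h (Nat.cast_nonneg H) hVH i)).2
    calc _ ≤ q * (d * (H : ℝ) ^ 2) := mul_le_mul hxx hθ (dotProduct_self_nonneg' _) hq0
      _ ≤ q * (τ ^ 2 * (H : ℝ) ^ 2) := by gcongr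
      _ = _ := by ring
  calc _ ≤ 13 * (H * τ) * √q + H * τ * √q := (abs_sub _ _).trans (add_le_add hnoise hbias)
    _ = _ := by ring

end Confidence

/-! ### Optimism -/

section Optimism

variable {S : Type u} {A : Type v} [Fintype S] {d H : ℕ} (mdp : LinearMDP S A d H)
  {am : (A → ℝ) → A} (ham : ∀ (q : A → ℝ) (a : A), q (am q) ≤ q a) {β : ℝ}
  {w : Fin H → Fin d → ℝ} (hw : ∀ h i, |w h i| ≤ 1) {k : ℕ} (hist : Fin k → Episode S A H)
  (hconf : ∀ h s a, |mdp.φ s a ⬝ᵥ regress mdp.φ (fun l => hist l h)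
        (lsviV mdp.φ am β w hist h.succ) -
      expect (mdp.P h s a) (lsviV mdp.φ am β w hist h.succ)| ≤
      bonus mdp.φ β (fun l => hist l h) s a)

include hw

/-- The one step lookahead of the optimistic values respects the truncation level. -/
lemma abs_cost_add_expect_le (h : Fin H) (s : S) (a : A) :
    |linearCost mdp.φ w h s a + expect (mdp.P h s a) (lsviV mdp.φ am β w hist h.succ)| ≤
      (H : ℝ) - (h : ℕ) := by
  have h1 : |linearCost mdp.φ w h s a| ≤ 1 :=
    abs_dotProduct_le_of_l1 (mdp.feature_norm s a) zero_le_one (hw h)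
  have h2 := abs_expect_le (mdp.P h s a) (abs_lsviV_le mdp.φ am β w hist h.succ)
  refine (abs_add_le _ _).trans ((add_le_add h1 h2).trans_eq ?_)
  rw [Fin.val_succ]; push_cast; ring

include hconf

lemma lsviQ_le (h : Fin H) (s : S) (a : A) :
    lsviQ mdp.φ am β w hist h s a ≤
      linearCost mdp.φ w h s a + expect (mdp.P h s a) (lsviV mdp.φ am β w hist h.succ) := by
  have h1 := (abs_le.1 (abs_cost_add_expect_le mdp hw hist (am := am) (β := β) h s a)).1
  have h2 := (abs_le.1 (hconf h s a)).2
  rw [lsviQ, lsviStep, clip]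
  refine max_le h1 ((min_le_right _ _).trans ?_)
  rw [linearCost] at *
  linarith

lemma le_lsviQ (h : Fin H) (s : S) (a : A) :
    linearCost mdp.φ w h s a + expect (mdp.P h s a) (lsviV mdp.φ am β w hist h.succ) -
      2 * bonus mdp.φ β (fun l => hist l h) s a ≤ lsviQ mdp.φ am β w hist h s a := by
  have h1 := (abs_le.1 (abs_cost_add_expect_le mdp hw hist (am := am) (β := β) h s a)).2
  have h2 := (abs_le.1 (hconf h s a)).1
  have h3 := (abs_nonneg _).trans (hconf h s a)
  rw [lsviQ, lsviStep, clip]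
  refine le_max_of_le_right (le_min (by linarith) ?_)
  rw [linearCost] at *
  linarith

variable [Fintype A]

include ham in
/-- The computed values are optimistic: they are below the values of all policies. -/
lemma lsviV_zero_le_value (π : Policy S A H) (s : S) :
    lsviV mdp.φ am β w hist 0 s ≤ mdp.value π (linearCost mdp.φ w) s := by
  have := expect_rollout_sum_le mdp.P π (fun h s a => -linearCost mdp.φ w h s a)
    (fun i s => -lsviV mdp.φ am β w hist i s) (fun h s => ?_)
    (fun s => by rw [lsviV_last, neg_zero]) s
  · simp only [Finset.sum_neg_distrib, expect_neg] at this
    rw [value_eq_expect]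
    linarith
  · refine expect_le _ fun a => ?_
    have h1 := lsviQ_le mdp hw hist hconf h s a
    have h2 := ham (lsviQ mdp.φ am β w hist h s) a
    rw [expect_neg, lsviV_castSucc]
    linarith

/-- The greedy policy loses at most the bonuses that it collects. -/
lemma value_greedy_le (s : S) :
    mdp.value (fun h s => PMF.pure (am (lsviQ mdp.φ am β w hist h s))) (linearCost mdp.φ w) s ≤
      lsviV mdp.φ am β w hist 0 s + expect (rollout H mdp.P
        (fun h s => PMF.pure (am (lsviQ mdp.φ am β w hist h s))) s)
          (fun x => ∑ h, 2 * bonus mdp.φ β (fun l => hist l h) (x h).1 (x h).2.1) := by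
  have := expect_rollout_sum_le mdp.P
    (fun h s => PMF.pure (am (lsviQ mdp.φ am β w hist h s)))
    (fun h s a => linearCost mdp.φ w h s a - 2 * bonus mdp.φ β (fun l => hist l h) s a)
    (lsviV mdp.φ am β w hist) (fun h s => ?_)
    (fun s => by rw [lsviV_last]) s
  · simp only [Finset.sum_sub_distrib, expect_sub] at this
    rw [value_eq_expect]
    linarith
  · rw [expect_pure, lsviV_castSucc]
    have h1 := le_lsviQ mdp hw hist hconf h s (am (lsviQ mdp.φ am β w hist h s))
    linarith

include ham in
lemma gap_greedy_le (π : Policy S A H) :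
    mdp.gap (fun h s => PMF.pure (am (lsviQ mdp.φ am β w hist h s))) π (linearCost mdp.φ w) ≤
      expect (mdp.episodeLaw fun h s => PMF.pure (am (lsviQ mdp.φ am β w hist h s)))
        (fun x => ∑ h, 2 * bonus mdp.φ β (fun l => hist l h) (x h).1 (x h).2.1) := by
  rw [gap_eq_expect, LinearMDP.episodeLaw, expect_bind]
  refine expect_mono _ fun s => ?_
  have h1 := lsviV_zero_le_value mdp ham hw hist hconf π s
  have h2 := value_greedy_le mdp hw hist hconf s
  linarith

end Optimism

/-! ### The regret of LSVI-UCB -/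

/-- The deviation that the Azuma–Hoeffding supermartingale allows, for the optimal choice of its
scale. -/
lemma le_of_exp_azuma_lt {x b B l K : ℝ} (hb : 0 < b) (hl : 0 < l) (hK : 0 < K)
    (hB : Real.log B ≤ 2 * l)
    (h : Real.exp (√(l / K) / b * x - K * ((√(l / K) / b) ^ 2 * b ^ 2 / 2)) < B) :
    x ≤ 3 * b * √(K * l) := by
  have h1 := (Real.lt_log_iff_exp_lt ((Real.exp_pos _).trans h)).2 h
  have hs : 0 < √(l / K) := Real.sqrt_pos.2 (by positivity)
  have e1 : K * ((√(l / K) / b) ^ 2 * b ^ 2 / 2) = l / 2 := by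
    rw [div_pow, Real.sq_sqrt (by positivity)]; field_simp
  have e2 : √(l / K) * √(K * l) = l := by
    rw [← Real.sqrt_mul (by positivity), show l / K * (K * l) = l ^ 2 by field_simp,
      Real.sqrt_sq hl.le]
  rw [e1] at h1
  have h2 : √(l / K) * x ≤ √(l / K) * (3 * b * √(K * l)) := by
    have : √(l / K) / b * x = √(l / K) * x / b := by ring
    rw [this] at h1
    have h3 : √(l / K) * x / b ≤ 3 * l := by linarith
    rw [div_le_iff₀ hb] at h3
    calc _ ≤ 3 * l * b := h3
      _ = 3 * (√(l / K) * √(K * l)) * b := by rw [e2]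
      _ = _ := by ring
  exact le_of_mul_le_mul_left h2 hs

/-- The grid that serves the confidence bound: it is fine enough for `K` episodes, and small enough
for a union bound at the cost of the factor `d²` in the logarithm. The exploration
parameter is `14 H τ` with `τ = 20 d √log(dHK/δ)`, and `exp (τ²)` has to dominate `2/δ` times the
number of supermartingales. -/
lemma exists_grid_parameters {d H K : ℕ} {δ : ℝ} (hd : 1 ≤ d) (hH : 1 ≤ H) (hK : 1 ≤ K)
    (hδ : 0 < δ) (hδ2 : δ ≤ 1 / 2) :
    ∃ n R : ℕ, 0 < n ∧ 1 + K * H ≤ R ∧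
      (K : ℝ) * (H / n + 14 * (H * (20 * d * √(Real.log (d * H * K / δ)))) * √(1 / n)) ≤ 1 ∧
      (Fintype.card (Fin K × Fin H × GridIndex d (n * R)) : ℝ) * (2 / δ) ≤
        Real.exp ((20 * d * √(Real.log (d * H * K / δ))) ^ 2) := by
  have hd' : (1 : ℝ) ≤ d := by exact_mod_cast hd
  have hH' : (1 : ℝ) ≤ H := by exact_mod_cast hH
  have hK' : (1 : ℝ) ≤ K := by exact_mod_cast hK
  set P : ℝ := d * H * K / δ with hP
  have hdHK : (1 : ℝ) ≤ d * H * K :=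
    one_le_mul_of_one_le_of_one_le (one_le_mul_of_one_le_of_one_le hd' hH') hK'
  have hPle : (d * H * K : ℝ) * 2 ≤ P := by
    rw [hP, le_div_iff₀ hδ]; nlinarith
  have hP2 : 2 ≤ P := by linarith
  have hHK : (K : ℝ) * H ≤ d * H * K := by
    rw [mul_assoc, mul_comm (K : ℝ)]
    exact le_mul_of_one_le_left (by positivity) hd'
  set ι := Real.log P with hι
  have hιP : Real.exp ι = P := Real.exp_log (by linarith)
  have hι0 : 0 ≤ ι := Real.log_nonneg (by linarith)
  set p : ℕ := ⌈P⌉₊ with hp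
  have hpP : P ≤ p := Nat.le_ceil P
  have hp1 : (p : ℝ) ≤ P ^ 2 := by
    have := (Nat.ceil_lt_add_one (show 0 ≤ P by linarith)).le
    nlinarith
  have hp2 : (2 : ℝ) ≤ p := hP2.trans hpP
  have hsι : √ι ≤ p := by
    rw [Real.sqrt_le_left (by linarith)]
    have := Real.log_le_sub_one_of_pos (show 0 < P by linarith)
    nlinarith
  -- `14 * 20 = 280` and `313600 = (2 * 280)²`: the mesh makes `K β √(1/n)` at most `1/2`
  refine ⟨313600 * p ^ 4, 2 * p, ?_, ?_, ?_, ?_⟩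
  · have : 0 < p := by exact_mod_cast (by linarith : (0 : ℝ) < p)
    positivity
  · have : (1 : ℝ) + K * H ≤ 2 * p := by nlinarith
    exact_mod_cast this
  · push_cast
    have e1 : √(1 / (313600 * (p : ℝ) ^ 4)) = 1 / (560 * (p : ℝ) ^ 2) := by
      rw [show (1 : ℝ) / (313600 * (p : ℝ) ^ 4) = (1 / (560 * (p : ℝ) ^ 2)) ^ 2 by
        field_simp; norm_num, Real.sqrt_sq (by positivity)]
    rw [e1, mul_add]
    have hpp : (0 : ℝ) < p := by linarith
    have h1 : (K : ℝ) * (H / (313600 * (p : ℝ) ^ 4)) ≤ 1 / 2 := by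
      rw [← mul_div_assoc, div_le_iff₀ (by positivity)]
      have : (p : ℝ) ≤ p ^ 4 := le_self_pow₀ (by linarith) (by norm_num)
      nlinarith
    have h2 : (K : ℝ) * (14 * (H * (20 * d * √ι)) * (1 / (560 * (p : ℝ) ^ 2))) ≤ 1 / 2 := by
      have : (K : ℝ) * (14 * (H * (20 * d * √ι)) * (1 / (560 * (p : ℝ) ^ 2))) =
          (d * H * K) * √ι / (2 * p ^ 2) := by field_simp; ring
      rw [this, div_le_iff₀ (by positivity)]
      have : (d * H * K : ℝ) * √ι ≤ p * p :=
        mul_le_mul (by linarith) hsι (Real.sqrt_nonneg _) hpp.le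
      linarith
    linarith
  · -- `(2m + 1)^(2d + d²)` grid points, and `2m + 1 ≤ 2²¹ p⁵ ≤ P³¹`
    have hbase : ((2 * (313600 * p ^ 4 * (2 * p)) + 1 : ℕ) : ℝ) ≤ Real.exp (31 * ι) := by
      have e : Real.exp (31 * ι) = P ^ 21 * P ^ 10 := by
        rw [← pow_add, ← hιP, ← Real.exp_nat_mul]; norm_num
      rw [e]
      have h1 : (2 : ℝ) ^ 21 ≤ P ^ 21 := pow_le_pow_left₀ (by norm_num) hP2 21
      have h2 : (p : ℝ) ^ 5 ≤ P ^ 10 := by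
        calc (p : ℝ) ^ 5 ≤ (P ^ 2) ^ 5 := pow_le_pow_left₀ (by linarith) hp1 5
          _ = _ := by ring
      have h3 : (1 : ℝ) ≤ (p : ℝ) ^ 5 := one_le_pow₀ (by linarith)
      calc _ ≤ (2 : ℝ) ^ 21 * (p : ℝ) ^ 5 := by push_cast; nlinarith
        _ ≤ _ := mul_le_mul h1 h2 (by positivity) (by positivity)
    have hcard : (Fintype.card (Fin K × Fin H × GridIndex d (313600 * p ^ 4 * (2 * p))) : ℝ) =
        K * (H * ((2 * (313600 * p ^ 4 * (2 * p)) + 1 : ℕ) : ℝ) ^ (2 * d + d ^ 2)) := by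
      simp only [GridIndex, Fintype.card_prod, Fintype.card_fin, Fintype.card_pi,
        Finset.prod_const, Finset.card_univ]
      push_cast
      ring
    rw [hcard]
    have h1 : ((2 * (313600 * p ^ 4 * (2 * p)) + 1 : ℕ) : ℝ) ^ (2 * d + d ^ 2) ≤
        Real.exp (93 * d ^ 2 * ι) := by
      refine (pow_le_pow_left₀ (by positivity) hbase _).trans ?_
      rw [← Real.exp_nat_mul]
      apply Real.exp_le_exp.2
      push_cast
      have : (2 * d + d ^ 2 : ℝ) ≤ 3 * d ^ 2 := by nlinarith
      calc _ ≤ (3 * d ^ 2 : ℝ) * (31 * ι) := by gcongr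
        _ = _ := by ring
    have h2 : (K : ℝ) * H * (2 / δ) ≤ Real.exp (2 * ι) := by
      have e : Real.exp (2 * ι) = P ^ 2 := by
        rw [← hιP, ← Real.exp_nat_mul]; norm_num
      rw [e]
      have : (K : ℝ) * H * (2 / δ) ≤ 2 * P := by
        rw [hP]
        calc _ = 2 * (K * H / δ) := by ring
          _ ≤ _ := by gcongr
      nlinarith
    calc _ = (K : ℝ) * H * (2 / δ) * _ := by ring
      _ ≤ Real.exp (2 * ι) * Real.exp (93 * d ^ 2 * ι) :=
          mul_le_mul h2 h1 (by positivity) (Real.exp_pos _).le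
      _ = Real.exp (2 * ι + 93 * d ^ 2 * ι) := (Real.exp_add _ _).symm
      _ ≤ _ := by
        apply Real.exp_le_exp.2
        rw [mul_pow, Real.sq_sqrt hι0]
        have : ι ≤ d ^ 2 * ι := le_mul_of_one_le_left hι0 (one_le_pow₀ hd')
        nlinarith

section Regret

variable {S : Type u} {A : Type v} [Fintype S] {d H : ℕ}

lemma abs_linearCost_le (mdp : LinearMDP S A d H) {w : Fin H → Fin d → ℝ} {b : ℝ} (hb : 0 ≤ b)
    (hw : ∀ h i, |w h i| ≤ b) (h : Fin H) (s : S) (a : A) : |linearCost mdp.φ w h s a| ≤ b :=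
  abs_dotProduct_le_of_l1 (mdp.feature_norm s a) hb (hw h)

lemma gap_le_of_abs_le [Fintype A] (mdp : LinearMDP S A d H) (π π' : Policy S A H) {c : Cost S A H}
    (hc : ∀ h s a, |c h s a| ≤ 1) : mdp.gap π π' c ≤ 2 * H := by
  have key : ∀ x : Episode S A H, |∑ h, c h (x h).1 (x h).2.1| ≤ H := fun x =>
    (Finset.abs_sum_le_sum_abs _ _).trans
      ((Finset.sum_le_card_nsmul _ _ 1 fun h _ => hc h _ _).trans_eq (by simp))
  rw [gap_eq_expect_episodeLaw]
  have h1 := (abs_le.1 (abs_expect_le (mdp.episodeLaw π) key)).2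
  have h2 := (abs_le.1 (abs_expect_le (mdp.episodeLaw π') key)).1
  linarith

/-- Twice the sum of the bonuses that an episode collects. -/
def episodeBonus (φ : S → A → Fin d → ℝ) (β : ℝ) {k : ℕ} (hist : Fin k → Episode S A H)
    (x : Episode S A H) : ℝ :=
  ∑ h, 2 * bonus φ β (fun l => hist l h) (x h).1 (x h).2.1

lemma episodeBonus_mem (mdp : LinearMDP S A d H) {β : ℝ} (hβ : 0 ≤ β) {k : ℕ}
    (hist : Fin k → Episode S A H) (x : Episode S A H) :
    0 ≤ episodeBonus mdp.φ β hist x ∧ episodeBonus mdp.φ β hist x ≤ 2 * H * β := by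
  constructor
  · exact Finset.sum_nonneg fun h _ => mul_nonneg two_pos.le (bonus_nonneg _ hβ _ _)
  · refine (Finset.sum_le_card_nsmul _ _ (2 * β) fun h _ => ?_).trans_eq (by simp; ring)
    exact mul_le_mul_of_nonneg_left (bonus_le _ mdp.feature_norm hβ _ _) two_pos.le

/-- One episode of regret. The first policy ignores the data, whence the trivial bound there. -/
lemma gap_lsviUCB_le [Fintype A] [Nonempty A] (mdp : LinearMDP S A d H) {am : (A → ℝ) → A}
    (ham : ∀ (q : A → ℝ) (a : A), q (am q) ≤ q a) {β : ℝ} (hβ : 0 ≤ β)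
    {W : CostPlayer S A d H} (hW : ∀ k hist h i, |W k hist h i| ≤ 1)
    (k : ℕ) (hist : Fin k → Episode S A H)
    (hconf : ∀ h s a, |mdp.φ s a ⬝ᵥ regress mdp.φ (fun l => hist l h)
        (lsviV mdp.φ am β (W k hist) hist h.succ) -
      expect (mdp.P h s a) (lsviV mdp.φ am β (W k hist) hist h.succ)| ≤
      bonus mdp.φ β (fun l => hist l h) s a) (πs : Policy S A H) :
    mdp.gap (lsviUCB mdp.φ am β W k hist) πs (linearCost mdp.φ (W k hist)) ≤
      (if k = 0 then 2 * (H : ℝ) else 0) +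
        expect (mdp.episodeLaw (lsviUCB mdp.φ am β W k hist)) (episodeBonus mdp.φ β hist) := by
  cases k with
  | zero =>
    have h1 := gap_le_of_abs_le mdp (lsviUCB mdp.φ am β W 0 hist) πs
      (abs_linearCost_le mdp zero_le_one (hW 0 hist))
    have h2 := expect_nonneg (mdp.episodeLaw (lsviUCB mdp.φ am β W 0 hist))
      (fun x => (episodeBonus_mem mdp hβ hist x).1)
    simp only [if_true]
    linarith
  | succ k =>
    simp only [Nat.succ_ne_zero, if_false, zero_add]
    exact gap_greedy_le mdp ham (hW _ hist) hist hconf πs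

lemma sum_episodeBonus_le (mdp : LinearMDP S A d H) {β : ℝ} (hβ : 0 ≤ β) {K : ℕ}
    (run : Fin K → Episode S A H) :
    ∑ k, episodeBonus mdp.φ β (past run k) (run k) ≤
      2 * H * (β * √(K * (2 * (d * Real.log (d * (1 + K)))))) := by
  unfold episodeBonus
  rw [Finset.sum_comm]
  refine (Finset.sum_le_card_nsmul _ _ (2 * (β * √(K * (2 * (d * Real.log (d * (1 + K)))))))
    fun h _ => ?_).trans_eq (by simp; ring)
  rw [← Finset.mul_sum]
  exact mul_le_mul_of_nonneg_left
    (sum_bonus_le mdp.feature_norm hβ fun k => run k h) two_pos.le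

lemma one_le_dim (mdp : LinearMDP S A d H) [Nonempty A] (hH : 1 ≤ H) : 1 ≤ d := by
  rcases Nat.eq_zero_or_pos d with rfl | hd
  · obtain ⟨s, -⟩ := mdp.init.support_nonempty
    obtain ⟨a⟩ := ‹Nonempty A›
    have h1 := sum_toReal_eq_one (mdp.P ⟨0, hH⟩ s a)
    simp [mdp.factor] at h1
  · exact hd

/-- The first episode, the martingale and the elliptical potential together. -/
lemma regret_arithmetic {d H K ι β l G : ℝ} (hd : 1 ≤ d) (hH : 1 ≤ H) (hK : 1 ≤ K)
    (hι : 1 / 2 ≤ ι) (hβ : β = 280 * d * H * √ι) (hl : l ≤ 2 * ι)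
    (hG : G ≤ 2 * H + 3 * (2 * H * β) * √(K * ι) + 2 * H * (β * √(K * (2 * (d * l))))) :
    G ≤ 3000 * H ^ 2 * d ^ (3 / 2 : ℝ) * √K * ι := by
  have hι0 : 0 ≤ ι := by linarith
  have hβ0 : 0 ≤ β := by rw [hβ]; positivity
  have hsqrt : √(K * (2 * (d * l))) ≤ 2 * (√d * √(K * ι)) := by
    rw [Real.sqrt_le_left (by positivity)]
    calc K * (2 * (d * l)) ≤ K * (2 * (d * (2 * ι))) := by gcongr
      _ = 4 * (√d ^ 2 * √(K * ι) ^ 2) := by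
        rw [Real.sq_sqrt (by positivity), Real.sq_sqrt (by positivity)]; ring
      _ = _ := by ring
  have hsd : 1 ≤ √d := Real.one_le_sqrt.2 hd
  have hsK : 1 ≤ √K := Real.one_le_sqrt.2 hK
  have hpow : d ^ (3 / 2 : ℝ) = d * √d := by
    rw [show (3 / 2 : ℝ) = 1 + 1 / 2 by norm_num, Real.rpow_add (by linarith), Real.rpow_one,
      ← Real.sqrt_eq_rpow]
  have hmain : 2 * H * (β * √(K * (2 * (d * l)))) ≤ 2 * H * (β * (2 * (√d * √(K * ι)))) := by
    gcongr
  have hmart : 3 * (2 * H * β) * √(K * ι) ≤ 3 * (2 * H * β) * (√d * √(K * ι)) := by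
    gcongr
    exact le_mul_of_one_le_left (Real.sqrt_nonneg _) hsd
  have hfirst : 2 * H ≤ 4 * (H ^ 2 * (d * √d) * √K * ι) := by
    have h1 : H ≤ H ^ 2 := by nlinarith
    have h2 : 1 ≤ d * √d * √K :=
      one_le_mul_of_one_le_of_one_le (one_le_mul_of_one_le_of_one_le hd hsd) hsK
    have h3 : H ^ 2 ≤ H ^ 2 * (d * √d * √K) := le_mul_of_one_le_right (by positivity) h2
    have h4 : H ^ 2 * (d * √d * √K) * (1 / 2) ≤ H ^ 2 * (d * √d * √K) * ι :=
      mul_le_mul_of_nonneg_left hι (by positivity)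
    calc _ ≤ 4 * (H ^ 2 * (d * √d * √K) * ι) := by linarith
      _ = _ := by ring
  have hX : 2 * H * (β * (2 * (√d * √(K * ι)))) + 3 * (2 * H * β) * (√d * √(K * ι)) =
      2800 * (H ^ 2 * (d * √d) * √K * √ι ^ 2) := by
    rw [Real.sqrt_mul (by linarith), hβ]; ring
  rw [Real.sq_sqrt hι0] at hX
  have hY : 0 ≤ H ^ 2 * (d * √d) * √K * ι := by positivity
  rw [hpow]
  calc _ ≤ 3000 * (H ^ 2 * (d * √d) * √K * ι) := by linarith
    _ = _ := by ring

/-- The regret bound holds on the event `f < 1` for a nonnegative `f` of expectation at most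
`δ`. -/
lemma exists_weight_regret_le [Fintype A] [Nonempty A] (mdp : LinearMDP S A d H) (hH : 1 ≤ H)
    {am : (A → ℝ) → A} (ham : ∀ (q : A → ℝ) (a : A), q (am q) ≤ q a) {δ : ℝ} (hδ : 0 < δ)
    (hδ2 : δ ≤ 1 / 2) {W : CostPlayer S A d H} (hW : ∀ k hist h i, |W k hist h i| ≤ 1)
    {K : ℕ} (hK : 1 ≤ K) :
    ∃ f : (Fin K → Episode S A H) → ℝ, (∀ run, 0 ≤ f run) ∧
      expect (mdp.interact (lsviUCB mdp.φ am (explorationParam 280 d H K δ) W) K) f ≤ δ ∧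
      ∀ run, f run < 1 → ∀ πs, mdp.regret am (explorationParam 280 d H K δ) W run πs ≤
        3000 * (H : ℝ) ^ 2 * (d : ℝ) ^ (3 / 2 : ℝ) * √(K : ℝ) * Real.log (d * H * K / δ) := by
  have hd := one_le_dim mdp hH
  obtain ⟨n, R, hn, hR, hkn, hcard⟩ := exists_grid_parameters hd hH hK hδ hδ2
  have hd' : (1 : ℝ) ≤ d := by exact_mod_cast hd
  have hH' : (1 : ℝ) ≤ H := by exact_mod_cast hH
  have hK' : (1 : ℝ) ≤ K := by exact_mod_cast hK
  have hdHK : (1 : ℝ) ≤ d * H * K :=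
    one_le_mul_of_one_le_of_one_le (one_le_mul_of_one_le_of_one_le hd' hH') hK'
  have hPle : (d * H * K : ℝ) * 2 ≤ d * H * K / δ := by
    rw [le_div_iff₀ hδ]; nlinarith
  set ι := Real.log (d * H * K / δ) with hι
  have hP2 : (2 : ℝ) ≤ d * H * K / δ := by linarith
  have hι1 : 1 / 2 ≤ ι := by
    have := Real.log_le_log two_pos hP2
    linarith [Real.log_two_gt_d9]
  -- logarithms of quantities up to `(dHK/δ)²`
  have hlog : ∀ y : ℝ, 0 < y → y ≤ 2 * (d * H * K / δ) → Real.log y ≤ 2 * ι := fun y hy hyle => by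
    have h1 := Real.log_le_log hy hyle
    rw [Real.log_mul two_ne_zero (by positivity)] at h1
    have h2 := Real.log_le_log two_pos hP2
    linarith
  have hlogK : Real.log (d * (1 + K)) ≤ 2 * ι := by
    refine hlog _ (by positivity) ?_
    have h1 : (d : ℝ) * (1 + K) ≤ 2 * (d * K) := by nlinarith
    have h2 : (d : ℝ) * K ≤ d * H * K :=
      mul_le_mul_of_nonneg_right (le_mul_of_one_le_right (by positivity) hH') (by positivity)
    linarith
  have hsι : 0 < √ι := Real.sqrt_pos.2 (by linarith)
  set τ := 20 * d * √ι with hτ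
  have hτ2 : τ ^ 2 = 400 * d ^ 2 * ι := by
    rw [hτ, mul_pow, Real.sq_sqrt (by linarith)]; ring
  have hτ0 : 0 ≤ τ := by positivity
  have hτd : (d : ℝ) ≤ τ ^ 2 := by rw [hτ2]; nlinarith
  have hτ1 : 1 ≤ τ := by nlinarith
  have hβ : explorationParam 280 d H K δ = 14 * (H * τ) := by
    rw [explorationParam, hτ]; ring
  rw [hβ]
  replace hβ : 14 * (H * τ) = 280 * d * H * √ι := hβ.symm
  set β := 14 * (H * τ) with hβ'
  have hβ0 : 0 < β := by positivity
  set L := lsviUCB mdp.φ am β W with hL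
  have hb : 0 < 2 * H * β := by positivity
  set t := √(ι / K) / (2 * H * β) with ht
  set Z : (Fin K → Episode S A H) → ℝ := fun run => Real.exp (t *
      (∑ j : Fin K, (-episodeBonus mdp.φ β (past run j) (run j) -
        expect (mdp.episodeLaw (L j (past run j)))
          (fun e => -episodeBonus mdp.φ β (past run j) e))) -
      K * (t ^ 2 * (2 * H * β) ^ 2 / 2)) with hZ
  have hEZ : expect (mdp.interact L K) Z ≤ 1 := by
    refine expect_interact_exp_azuma_le_one mdp L
      (fun j hist e => -episodeBonus mdp.φ β hist e) (b := 2 * H * β) (fun j hist e => ?_) t K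
    have h1 := episodeBonus_mem mdp hβ0.le hist e
    have h2 := le_expect (mdp.episodeLaw (L j hist))
      fun x => (episodeBonus_mem mdp hβ0.le hist x).1
    have h3 := expect_le (mdp.episodeLaw (L j hist))
      fun x => (episodeBonus_mem mdp hβ0.le hist x).2
    rw [expect_neg, abs_le]
    constructor <;> linarith
  refine ⟨fun run => δ / 2 * confWeight mdp am β (τ / H) (n * R) n run + δ / 2 * Z run,
    fun run => add_nonneg (mul_nonneg (by positivity) (confWeight_nonneg _ _ _ _ _ _ _))
      (mul_nonneg (by positivity) (Real.exp_pos _).le), ?_, fun run hrun πs => ?_⟩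
  · rw [expect_add, expect_const_mul, expect_const_mul]
    have := expect_confWeight_le_one mdp am β (τ / H) (n * R) n L K
    nlinarith
  have hZ0 : 0 < Z run := Real.exp_pos _
  have hc0 := confWeight_nonneg mdp am β (τ / H) (n * R) n run
  have hc1 : confWeight mdp am β (τ / H) (n * R) n run < 2 / δ := by
    rw [lt_div_iff₀ hδ]; nlinarith
  have hZ1 : Z run < 2 / δ := by
    rw [lt_div_iff₀ hδ]; nlinarith
  have hconf := sum_confIncrement_le_of_confWeight_lt hc1 hcard
  have hstep : ∀ k : Fin K, mdp.gap (L k (past run k)) πs (linearCost mdp.φ (W k (past run k))) ≤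
      (if (k : ℕ) = 0 then 2 * (H : ℝ) else 0) +
        expect (mdp.episodeLaw (L k (past run k))) (episodeBonus mdp.φ β (past run k)) := by
    intro k
    refine gap_lsviUCB_le mdp ham hβ0.le hW k (past run k) (fun h s a => ?_) πs
    refine abs_dotProduct_regress_sub_expect_le mdp hH ham h hτ1 hτd hn (R := R) ?_ ?_
      (past run k) (hconf k h) (hW _ _) s a
    · exact (Nat.add_le_add_left (Nat.mul_le_mul_right H k.isLt.le) 1).trans hR
    · refine le_trans (mul_le_mul_of_nonneg_right ?_ (by positivity)) hkn
      exact_mod_cast k.isLt.le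
  have hfirst : ∑ k : Fin K, (if (k : ℕ) = 0 then 2 * (H : ℝ) else 0) = 2 * H := by
    obtain ⟨K', rfl⟩ : ∃ K', K = K' + 1 := ⟨K - 1, by omega⟩
    simp
  have hmart : ∑ k : Fin K, (expect (mdp.episodeLaw (L k (past run k)))
      (episodeBonus mdp.φ β (past run k)) - episodeBonus mdp.φ β (past run k) (run k)) ≤
      3 * (2 * H * β) * √(K * ι) := by
    refine le_of_exp_azuma_lt hb (by linarith) (by linarith) (hlog (2 / δ) (by positivity) ?_)
      (lt_of_eq_of_lt ?_ hZ1)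
    · rw [show (2 : ℝ) / δ = 2 * (1 / δ) by ring]
      gcongr
    · rw [hZ, ht]
      simp only [expect_neg, neg_sub_neg]
  have hpot := sum_episodeBonus_le mdp hβ0.le run
  have hsum := Finset.sum_le_sum fun k (_ : k ∈ Finset.univ) => hstep k
  rw [Finset.sum_add_distrib, hfirst] at hsum
  rw [Finset.sum_sub_distrib, sub_le_iff_le_add] at hmart
  refine regret_arithmetic hd' hH' hK' hι1 hβ hlogK (hsum.trans ?_)
  rw [add_assoc]
  exact add_le_add le_rfl (hmart.trans (add_le_add le_rfl hpot))

end Regret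

/-! ### Projected online gradient descent -/

section Projection

variable {d : ℕ}

lemma norm_toLp_sq (x : Fin d → ℝ) : ‖WithLp.toLp 2 x‖ ^ 2 = x ⬝ᵥ x := by
  rw [EuclideanSpace.real_norm_sq_eq]
  exact Finset.sum_congr rfl fun i _ => pow_two _

/-- Nonempty, closed and convex for the Euclidean norm: the sets onto which `proj` projects. -/
structure Projectable (W : Set (Fin d → ℝ)) : Prop where
  nonempty : W.Nonempty
  closed : IsClosed {v : EuclideanSpace ℝ (Fin d) | v.ofLp ∈ W}
  convex : Convex ℝ {v : EuclideanSpace ℝ (Fin d) | v.ofLp ∈ W}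

lemma Projectable.proj_spec {W : Set (Fin d → ℝ)} (hW : Projectable W) (x : Fin d → ℝ) :
    proj W x ∈ W ∧ ∀ y ∈ W, ‖WithLp.toLp 2 (x - proj W x)‖ ≤ ‖WithLp.toLp 2 (x - y)‖ := by
  obtain ⟨w, hw⟩ := hW.nonempty
  obtain ⟨p, hp, hmin⟩ := exists_norm_eq_iInf_of_complete_convex
    (K := {v : EuclideanSpace ℝ (Fin d) | v.ofLp ∈ W}) ⟨WithLp.toLp 2 w, hw⟩
    hW.closed.isComplete hW.convex (WithLp.toLp 2 x)
  refine Classical.epsilon_spec (p := fun p => p ∈ W ∧ ∀ y ∈ W,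
    ‖WithLp.toLp 2 (x - p)‖ ≤ ‖WithLp.toLp 2 (x - y)‖) ⟨p.ofLp, hp, fun y hy => ?_⟩
  have h1 : WithLp.toLp 2 (x - p.ofLp) = WithLp.toLp 2 x - p := rfl
  rw [h1, hmin]
  exact ciInf_le (f := fun v : {v : EuclideanSpace ℝ (Fin d) | v.ofLp ∈ W} =>
    ‖WithLp.toLp 2 x - (v : EuclideanSpace ℝ (Fin d))‖)
    ⟨0, by rintro _ ⟨v, rfl⟩; exact norm_nonneg _⟩ ⟨WithLp.toLp 2 y, hy⟩

/-- Projection does not increase the distance to the points of the set. -/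
lemma Projectable.proj_sub_dotProduct_le {W : Set (Fin d → ℝ)} (hW : Projectable W)
    (x : Fin d → ℝ) {y : Fin d → ℝ} (hy : y ∈ W) :
    (proj W x - y) ⬝ᵥ (proj W x - y) ≤ (x - y) ⬝ᵥ (x - y) := by
  obtain ⟨hp, hmin⟩ := hW.proj_spec x
  set p := proj W x
  have : Nonempty {v : EuclideanSpace ℝ (Fin d) | v.ofLp ∈ W} := ⟨⟨WithLp.toLp 2 p, hp⟩⟩
  have hinf : ‖WithLp.toLp 2 x - WithLp.toLp 2 p‖ =
      ⨅ v : {v : EuclideanSpace ℝ (Fin d) | v.ofLp ∈ W},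
        ‖WithLp.toLp 2 x - (v : EuclideanSpace ℝ (Fin d))‖ :=
    le_antisymm (le_ciInf fun v => hmin _ v.2)
      (ciInf_le (f := fun v : {v : EuclideanSpace ℝ (Fin d) | v.ofLp ∈ W} =>
        ‖WithLp.toLp 2 x - (v : EuclideanSpace ℝ (Fin d))‖)
        ⟨0, by rintro _ ⟨v, rfl⟩; exact norm_nonneg _⟩ ⟨WithLp.toLp 2 p, hp⟩)
  have hin := (norm_eq_iInf_iff_real_inner_le_zero hW.convex
    (show WithLp.toLp 2 p ∈ {v : EuclideanSpace ℝ (Fin d) | v.ofLp ∈ W} from hp)).1 hinf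
    (WithLp.toLp 2 y) hy
  have e : (x - y) ⬝ᵥ (x - y) = (x - p) ⬝ᵥ (x - p) + (p - y) ⬝ᵥ (p - y) -
      2 * ((x - p) ⬝ᵥ (y - p)) := by
    simp only [sub_dotProduct, dotProduct_sub, dotProduct_comm y x, dotProduct_comm p x,
      dotProduct_comm y p]
    ring
  have h2 : (x - p) ⬝ᵥ (y - p) ≤ 0 := by
    have h3 : inner ℝ (WithLp.toLp 2 x - WithLp.toLp 2 p) (WithLp.toLp 2 y - WithLp.toLp 2 p) =
        (x - p) ⬝ᵥ (y - p) := by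
      rw [← WithLp.toLp_sub, ← WithLp.toLp_sub, EuclideanSpace.inner_toLp_toLp, dotProduct_comm]
      simp
    rw [← h3]; exact hin
  linarith [dotProduct_self_nonneg' (x - p)]

lemma projectable_unitBall : Projectable (unitBall d) where
  nonempty := ⟨0, by simp [unitBall]⟩
  closed := by
    have : {v : EuclideanSpace ℝ (Fin d) | v.ofLp ∈ unitBall d} = Metric.closedBall 0 1 := by
      ext v; simp [unitBall]
    rw [this]; exact Metric.isClosed_closedBall
  convex := by
    have : {v : EuclideanSpace ℝ (Fin d) | v.ofLp ∈ unitBall d} = Metric.closedBall 0 1 := by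
      ext v; simp [unitBall]
    rw [this]; exact convex_closedBall 0 1

lemma projectable_unitBox : Projectable (unitBox d) where
  nonempty := ⟨0, fun i => by simp⟩
  closed := by
    have : {v : EuclideanSpace ℝ (Fin d) | v.ofLp ∈ unitBox d} =
        ⋂ i, {v | 0 ≤ v.ofLp i} ∩ {v | v.ofLp i ≤ 1} := by
      ext v; simp [unitBox]
    rw [this]
    exact isClosed_iInter fun i =>
      (isClosed_le continuous_const (by fun_prop)).inter
        (isClosed_le (by fun_prop) continuous_const)
  convex := by
    intro x hx y hy a b ha hb hab i
    obtain ⟨h1, h2⟩ := hx i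
    obtain ⟨h3, h4⟩ := hy i
    simp only [WithLp.ofLp_add, WithLp.ofLp_smul, Pi.add_apply, Pi.smul_apply, smul_eq_mul]
    constructor
    · positivity
    · nlinarith

lemma mem_unitBall_iff {w : Fin d → ℝ} : w ∈ unitBall d ↔ w ⬝ᵥ w ≤ 1 := by
  rw [← norm_toLp_sq, sq_le_one_iff₀ (norm_nonneg _)]; rfl

lemma abs_apply_le_one_of_mem {W : Set (Fin d → ℝ)} (hW : W = unitBox d ∨ W = unitBall d)
    {w : Fin d → ℝ} (hw : w ∈ W) (i : Fin d) : |w i| ≤ 1 := by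
  rcases hW with rfl | rfl
  · exact abs_le.2 ⟨by linarith [(hw i).1], (hw i).2⟩
  · exact (sq_le_one_iff_abs_le_one _).1
      ((sq_le_dotProduct_self w i).trans (mem_unitBall_iff.1 hw))

lemma projectable_of_eq {W : Set (Fin d → ℝ)} (hW : W = unitBox d ∨ W = unitBall d) :
    Projectable W := by
  rcases hW with rfl | rfl
  · exact projectable_unitBox
  · exact projectable_unitBall

lemma sub_dotProduct_sub_le {w w' : Fin d → ℝ} (hw : ∀ i, |w i| ≤ 1) (hw' : ∀ i, |w' i| ≤ 1) :
    (w - w') ⬝ᵥ (w - w') ≤ 4 * d := by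
  refine (Finset.sum_le_card_nsmul _ _ 4 fun i _ => ?_).trans_eq (by simp; ring)
  have h1 := abs_le.1 (hw i)
  have h2 := abs_le.1 (hw' i)
  rw [← pow_two, Pi.sub_apply]
  nlinarith

lemma sum_abs_sub_le {x y : Fin d → ℝ} (hx : ∑ i, |x i| ≤ 1) (hy : ∑ i, |y i| ≤ 1) :
    ∑ i, |(x - y) i| ≤ 2 :=
  calc ∑ i, |(x - y) i| ≤ ∑ i, (|x i| + |y i|) := Finset.sum_le_sum fun i _ => abs_sub _ _
    _ ≤ 2 := by rw [Finset.sum_add_distrib]; linarith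

lemma sub_dotProduct_sub_le_four {x y : Fin d → ℝ} (hx : ∑ i, |x i| ≤ 1)
    (hy : ∑ i, |y i| ≤ 1) : (x - y) ⬝ᵥ (x - y) ≤ 4 := by
  have h := sum_abs_sub_le hx hy
  refine (le_abs_self _).trans ((abs_dotProduct_le_mul h two_pos.le fun i => ?_).trans_eq
    (by norm_num))
  exact (Finset.single_le_sum (f := fun i => |(x - y) i|) (fun _ _ => abs_nonneg _)
    (Finset.mem_univ i)).trans h

end Projection

section Descent

variable {S : Type u} {A : Type v} {d H : ℕ}

/-- Projected online gradient descent for the linear losses with gradients `g`. -/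
def descent (W : Set (Fin d → ℝ)) (α : ℝ) (w₁ : Fin H → Fin d → ℝ)
    (g : Episode S A H → Fin H → Fin d → ℝ) : CostPlayer S A d H
  | 0, _ => w₁
  | k + 1, hist => fun h =>
      proj W (descent W α w₁ g k (fun l => hist l.castSucc) h - α • g (hist (Fin.last k)) h)

lemma ogd_eq_descent (φ : S → A → Fin d → ℝ) (W : Set (Fin d → ℝ)) (α : ℝ)
    (w₁ : Fin H → Fin d → ℝ) {N : ℕ} (D : Fin N → Episode S A H) (k : ℕ)
    (hist : Fin k → Episode S A H) :
    ogd φ W α w₁ D k hist = descent W α w₁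
      (fun e h => expertFeatures φ D h - φ (e h).1 (e h).2.1) k hist := by
  induction k with
  | zero => rfl
  | succ k ih =>
    funext h
    rw [ogd, descent, ih]

lemma descent_mem {W : Set (Fin d → ℝ)} (hW : Projectable W) (α : ℝ) {w₁ : Fin H → Fin d → ℝ}
    (hw₁ : ∀ h, w₁ h ∈ W) (g : Episode S A H → Fin H → Fin d → ℝ) (k : ℕ)
    (hist : Fin k → Episode S A H) (h : Fin H) : descent W α w₁ g k hist h ∈ W := by
  cases k with
  | zero => exact hw₁ h
  | succ k => exact (hW.proj_spec _).1

/-- The regret of projected gradient descent, with the final distance to the comparator. -/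
lemma descent_regret_le {W : Set (Fin d → ℝ)} (hW : Projectable W) (α : ℝ)
    (w₁ : Fin H → Fin d → ℝ) (g : Episode S A H → Fin H → Fin d → ℝ) {γ : ℝ} (h : Fin H)
    (hg : ∀ e, g e h ⬝ᵥ g e h ≤ γ) {w : Fin d → ℝ} (hw : w ∈ W) {K : ℕ}
    (run : Fin K → Episode S A H) :
    2 * α * ∑ k, g (run k) h ⬝ᵥ (descent W α w₁ g k (past run k) h - w) +
      (descent W α w₁ g K run h - w) ⬝ᵥ (descent W α w₁ g K run h - w) ≤
      (w₁ h - w) ⬝ᵥ (w₁ h - w) + K * (α ^ 2 * γ) := by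
  induction K with
  | zero => simp [descent]
  | succ n ih =>
    have h1 := ih fun l => run l.castSucc
    rw [Fin.sum_univ_castSucc]
    set v := descent W α w₁ g n (fun l => run l.castSucc) h with hv
    set G := g (run (Fin.last n)) h with hG
    have h2 : (descent W α w₁ g (n + 1) run h - w) ⬝ᵥ (descent W α w₁ g (n + 1) run h - w) ≤
        (v - α • G - w) ⬝ᵥ (v - α • G - w) := hW.proj_sub_dotProduct_le _ hw
    have h3 : (v - α • G - w) ⬝ᵥ (v - α • G - w) =
        (v - w) ⬝ᵥ (v - w) - 2 * α * (G ⬝ᵥ (v - w)) + α ^ 2 * (G ⬝ᵥ G) := by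
      rw [show v - α • G - w = (v - w) - α • G by abel]
      simp only [sub_dotProduct, dotProduct_sub, dotProduct_smul, smul_dotProduct, smul_eq_mul,
        dotProduct_comm w G, dotProduct_comm v G]
      ring
    have h4 : α ^ 2 * (G ⬝ᵥ G) ≤ α ^ 2 * γ := mul_le_mul_of_nonneg_left (hg _) (sq_nonneg _)
    change 2 * α * (∑ k : Fin n, g (run k.castSucc) h ⬝ᵥ
      (descent W α w₁ g k (past (fun l => run l.castSucc) k) h - w) + G ⬝ᵥ (v - w)) + _ ≤ _
    push_cast
    linarith

end Descent

/-! ### Feature expectations -/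

section Features

variable {S : Type u} {A : Type v} [Fintype S] [Fintype A] {d H : ℕ}

/-- The feature expectations `E_π φ(s_h, a_h)`. -/
def meanFeatures (mdp : LinearMDP S A d H) (π : Policy S A H) (h : Fin H) : Fin d → ℝ :=
  fun i => expect (mdp.episodeLaw π) fun e => mdp.φ (e h).1 (e h).2.1 i

lemma expect_sum_features_dotProduct (mdp : LinearMDP S A d H) (π : Policy S A H)
    (v : Fin H → Fin d → ℝ) :
    expect (mdp.episodeLaw π) (fun e => ∑ h, mdp.φ (e h).1 (e h).2.1 ⬝ᵥ v h) =
      ∑ h, meanFeatures mdp π h ⬝ᵥ v h := by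
  rw [expect_sum]
  refine Finset.sum_congr rfl fun h _ => ?_
  simp only [dotProduct, expect_sum, expect_mul_const, meanFeatures]

lemma sum_abs_meanFeatures_le (mdp : LinearMDP S A d H) (π : Policy S A H) (h : Fin H) :
    ∑ i, |meanFeatures mdp π h i| ≤ 1 := by
  have h1 : ∀ i, |meanFeatures mdp π h i| ≤
      expect (mdp.episodeLaw π) fun e => |mdp.φ (e h).1 (e h).2.1 i| := fun i => by
    rw [abs_le, meanFeatures, ← expect_neg]
    exact ⟨expect_mono _ fun e => neg_abs_le _, expect_mono _ fun e => le_abs_self _⟩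
  refine (Finset.sum_le_sum fun i _ => h1 i).trans ?_
  rw [← expect_sum]
  exact expect_le _ fun e => mdp.feature_norm _ _

lemma sum_abs_expertFeatures_le {A : Type v} (mdp : LinearMDP S A d H) {N : ℕ}
    (D : Fin N → Episode S A H) (h : Fin H) : ∑ i, |expertFeatures mdp.φ D h i| ≤ 1 := by
  have h1 : ∀ i, |expertFeatures mdp.φ D h i| ≤
      (N : ℝ)⁻¹ * ∑ n, |mdp.φ (D n h).1 (D n h).2.1 i| := fun i => by
    simp only [expertFeatures, Pi.smul_apply, Finset.sum_apply, smul_eq_mul, abs_mul]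
    rw [abs_of_nonneg (by positivity)]
    exact mul_le_mul_of_nonneg_left (Finset.abs_sum_le_sum_abs _ _) (by positivity)
  refine (Finset.sum_le_sum fun i _ => h1 i).trans ?_
  rw [← Finset.mul_sum, Finset.sum_comm]
  refine (mul_le_mul_of_nonneg_left (Finset.sum_le_card_nsmul _ _ 1 fun n _ =>
    mdp.feature_norm _ _) (by positivity)).trans ?_
  simpa using inv_mul_le_one (a := (N : ℝ))

lemma gap_linearCost_eq (mdp : LinearMDP S A d H) (π π' : Policy S A H)
    (w : Fin H → Fin d → ℝ) :
    mdp.gap π π' (linearCost mdp.φ w) =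
      ∑ h, (meanFeatures mdp π h - meanFeatures mdp π' h) ⬝ᵥ w h := by
  rw [gap_eq_expect_episodeLaw]
  simp only [linearCost, sub_dotProduct, Finset.sum_sub_distrib]
  rw [expect_sum_features_dotProduct, expect_sum_features_dotProduct]

/-- The error of the empirical feature expectations, in all directions of the unit balls at once.
The supremum over the directions is replaced by online gradient descent on the unit ball: its
iterates are predictable, so that their correlation with the noise is a scalar martingale. -/
lemma exists_weight_expertFeatures_le (mdp : LinearMDP S A d H) (hH : 1 ≤ H)
    (πE : Policy S A H) {N : ℕ} (hN : 1 ≤ N) {l : ℝ} (hl : 1 / 2 ≤ l) {δ : ℝ}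
    (hδl : Real.log (1 / δ) ≤ 2 * l) :
    ∃ Z : (Fin N → Episode S A H) → ℝ, (∀ D, 0 ≤ Z D) ∧
      expect (mdp.interact (fun _ _ => πE) N) Z ≤ 1 ∧
      ∀ D, Z D < 1 / δ → ∀ v : Fin H → Fin d → ℝ, (∀ h, v h ⬝ᵥ v h ≤ 1) →
        ∑ h, (expertFeatures mdp.φ D h - meanFeatures mdp πE h) ⬝ᵥ v h ≤ 10 * H * √(l / N) := by
  have hH' : (1 : ℝ) ≤ H := by exact_mod_cast hH
  have hN' : (1 : ℝ) ≤ N := by exact_mod_cast hN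
  have hsN : 0 < √(N : ℝ) := Real.sqrt_pos.2 (by linarith)
  set m := meanFeatures mdp πE with hm
  -- gradients of squared norm at most `4` and a comparator at distance at most `1` of the start
  set α : ℝ := 1 / (2 * √N) with hα
  set g : Episode S A H → Fin H → Fin d → ℝ := fun e h => m h - mdp.φ (e h).1 (e h).2.1 with hg
  set U := descent (unitBall d) α (fun _ => 0) g with hU
  have hUmem : ∀ k hist h, U k hist h ∈ unitBall d := fun k hist h =>
    descent_mem projectable_unitBall α (fun _ => by simp [unitBall]) g k hist h
  set Y : (j : ℕ) → (Fin j → Episode S A H) → Episode S A H → ℝ := fun j hist e =>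
    ∑ h, (mdp.φ (e h).1 (e h).2.1 - m h) ⬝ᵥ U j hist h with hY
  have hYabs : ∀ j hist e, |Y j hist e| ≤ 2 * H := fun j hist e =>
    (Finset.abs_sum_le_sum_abs _ _).trans ((Finset.sum_le_card_nsmul _ _ (2 * 1) fun h _ =>
      abs_dotProduct_le_mul (sum_abs_sub_le (mdp.feature_norm _ _)
        (sum_abs_meanFeatures_le mdp πE h)) zero_le_one
        (abs_apply_le_one_of_mem (Or.inr rfl) (hUmem j hist h))).trans_eq (by simp; ring))
  have hYmean : ∀ j hist, expect (mdp.episodeLaw πE) (Y j hist) = 0 := fun j hist => by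
    simp only [hY, sub_dotProduct, Finset.sum_sub_distrib, expect_sub, expect_const,
      expect_sum_features_dotProduct, hm, sub_self]
  set t := √(l / N) / (2 * H) with ht
  have hE := expect_interact_exp_azuma_le_one mdp (fun _ _ => πE) Y (b := 2 * H)
    (fun j hist e => by rw [hYmean, sub_zero]; exact hYabs j hist e) t N
  refine ⟨_, fun D => (Real.exp_pos _).le, hE, fun D hD v hv => ?_⟩
  have hmart := le_of_exp_azuma_lt (by positivity) (by linarith) (by linarith) hδl hD
  simp only [hYmean, sub_zero] at hmart
  have hreg : ∀ h, ∑ k, g (D k) h ⬝ᵥ (U k (past D k) h - v h) ≤ 2 * √N := fun h => by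
    have h1 := descent_regret_le projectable_unitBall α (fun _ => 0) g (γ := 4) h
      (fun e => sub_dotProduct_sub_le_four (sum_abs_meanFeatures_le mdp πE h)
        (mdp.feature_norm _ _)) (mem_unitBall_iff.2 (hv h)) D
    have h2 := dotProduct_self_nonneg' (descent (unitBall d) α (fun _ => 0) g N D h - v h)
    have h3 : ((0 : Fin d → ℝ) - v h) ⬝ᵥ ((0 : Fin d → ℝ) - v h) ≤ 1 := by
      rw [zero_sub, neg_dotProduct_neg]; exact hv h
    have h4 : (N : ℝ) * (α ^ 2 * 4) = 1 := by
      rw [hα, div_pow, mul_pow, Real.sq_sqrt (by linarith)]; field_simp; norm_num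
    have h5 : 2 * α * ∑ k, g (D k) h ⬝ᵥ (U k (past D k) h - v h) ≤ 2 := by linarith
    rw [hα, show 2 * (1 / (2 * √(N : ℝ))) = 1 / √N by field_simp, one_div,
      inv_mul_le_iff₀ hsN] at h5
    linarith
  have hregsum := Finset.sum_le_sum fun h (_ : h ∈ Finset.univ) => hreg h
  rw [Finset.sum_const, Finset.card_univ, Fintype.card_fin, nsmul_eq_mul] at hregsum
  -- the left-hand side is the average over the data of `⟨φ - m, v⟩`
  have hsplit : (N : ℝ) * ∑ h, (expertFeatures mdp.φ D h - m h) ⬝ᵥ v h =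
      ∑ k : Fin N, Y k (past D k) (D k) + ∑ h, ∑ k, g (D k) h ⬝ᵥ (U k (past D k) h - v h) := by
    rw [Finset.sum_comm (s := Finset.univ (α := Fin H)), ← Finset.sum_add_distrib]
    have e1 : ∀ k : Fin N, Y k (past D k) (D k) + ∑ h, g (D k) h ⬝ᵥ (U k (past D k) h - v h) =
        ∑ h, (mdp.φ (D k h).1 (D k h).2.1 - m h) ⬝ᵥ v h := fun k => by
      rw [hY, ← Finset.sum_add_distrib]
      refine Finset.sum_congr rfl fun h _ => ?_
      simp only [hg, sub_dotProduct, dotProduct_sub]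
      ring
    simp only [e1]
    rw [Finset.sum_comm, Finset.mul_sum]
    refine Finset.sum_congr rfl fun h _ => ?_
    rw [← sum_dotProduct, ← smul_eq_mul, ← smul_dotProduct]
    congr 1
    rw [smul_sub, expertFeatures, smul_inv_smul₀ (by linarith), Finset.sum_sub_distrib,
      Finset.sum_const, Finset.card_univ, Fintype.card_fin, ← Nat.cast_smul_eq_nsmul ℝ]
  have hNl : √(N * l) = N * √(l / N) := by
    rw [show (N : ℝ) * l = N ^ 2 * (l / N) by field_simp, Real.sqrt_mul (by positivity),
      Real.sqrt_sq (by positivity)]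
  have hsl : √(N : ℝ) ≤ 2 * √(N * l) := by
    rw [Real.sqrt_le_left (by positivity), mul_pow, Real.sq_sqrt (by positivity)]
    nlinarith
  have hfin : (N : ℝ) * ∑ h, (expertFeatures mdp.φ D h - m h) ⬝ᵥ v h ≤
      N * (10 * H * √(l / N)) := by
    rw [hsplit]
    have : (H : ℝ) * (2 * √N) ≤ H * (2 * (2 * √(N * l))) := by gcongr
    calc _ ≤ 3 * (2 * H) * √(N * l) + H * (2 * √N) := add_le_add hmart hregsum
      _ ≤ 10 * H * √(N * l) := by linarith
      _ = _ := by rw [hNl]; ring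
  exact le_of_mul_le_mul_left hfin (by linarith)

end Features

/-! ### The guarantee of BRIG -/

/-- The number of episodes turns the regret bound into an average of order `ε`, although the
logarithm in the regret bound contains that number. -/
lemma mul_sqrt_mul_log_le {d H K ε δ : ℝ} (hd : 1 ≤ d) (hH : 1 ≤ H) (hK : 0 < K) (hε : 0 < ε)
    (hε1 : ε ≤ 1) (hδ : 0 < δ) (hδ1 : δ < 1)
    (hKle : H ^ 4 * d ^ 3 * Real.log (d * H / (ε * δ)) ^ 2 / ε ^ 2 ≤ K) :
    H ^ 2 * d ^ (3 / 2 : ℝ) * √K * Real.log (d * H * K / δ) ≤ 7 * ε * K := by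
  have hd0 : 0 < d := by linarith
  have hH0 : 0 < H := by linarith
  set D := d ^ (3 / 2 : ℝ) with hD
  have hD0 : 0 < D := Real.rpow_pos_of_pos hd0 _
  have hD2 : D ^ 2 = d ^ 3 := by
    rw [hD, ← Real.rpow_natCast, ← Real.rpow_mul hd0.le, ← Real.rpow_natCast]; norm_num
  have hlogD : Real.log D = 3 / 2 * Real.log d := Real.log_rpow hd0 _
  have hsK : 0 < √K := Real.sqrt_pos.2 hK
  have hsK2 : √K * √K = K := Real.mul_self_sqrt hK.le
  set l := Real.log (d * H / (ε * δ)) with hl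
  have e1 : l = Real.log d + Real.log H - Real.log ε - Real.log δ := by
    rw [hl, Real.log_div (by positivity) (by positivity), Real.log_mul hd0.ne' hH0.ne',
      Real.log_mul hε.ne' hδ.ne']
    ring
  have hld : 0 ≤ Real.log d := Real.log_nonneg hd
  have hlH : 0 ≤ Real.log H := Real.log_nonneg hH
  have hlε : Real.log ε ≤ 0 := Real.log_nonpos hε.le hε1
  have hlδ : Real.log δ ≤ 0 := Real.log_nonpos hδ.le hδ1.le
  -- `y²` is the ratio of `K` and `H⁴ d³ / ε²`
  set y := √K * ε / (H ^ 2 * D) with hy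
  have hy0 : 0 < y := by positivity
  have hly : l ≤ y := by
    rw [hy, le_div_iff₀ (by positivity)]
    rw [div_le_iff₀ (by positivity)] at hKle
    refine le_of_sq_le_sq ?_ (by positivity)
    calc (l * (H ^ 2 * D)) ^ 2 = H ^ 4 * D ^ 2 * l ^ 2 := by ring
      _ ≤ K * ε ^ 2 := by rw [hD2]; exact hKle
      _ = (√K * ε) ^ 2 := by rw [mul_pow, pow_two (√K), hsK2]
  have hlogy : Real.log y =
      Real.log K / 2 + Real.log ε - (2 * Real.log H + 3 / 2 * Real.log d) := by
    rw [hy, Real.log_div (by positivity) (by positivity), Real.log_mul hsK.ne' hε.ne',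
      Real.log_mul (by positivity) hD0.ne', Real.log_sqrt hK.le, Real.log_pow, hlogD]
    norm_num
  have hlogy1 : Real.log y ≤ y - 1 := Real.log_le_sub_one_of_pos hy0
  have e2 : Real.log (d * H * K / δ) ≤ 7 * y := by
    rw [Real.log_div (by positivity) hδ.ne', Real.log_mul (by positivity) hK.ne',
      Real.log_mul hd0.ne' hH0.ne']
    linarith
  calc H ^ 2 * D * √K * Real.log (d * H * K / δ) ≤ H ^ 2 * D * √K * (7 * y) := by gcongr
    _ = 7 * ε * (√K * √K) := by rw [hy]; field_simp
    _ = _ := by rw [hsK2]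

section Guarantee

variable {S : Type u} {A : Type v} [Fintype S] [Fintype A] {d H : ℕ}

/-- Changing the cost weights from `w` to `w'` changes the gap by the error of the empirical
features `Φ`, a regret term of gradient descent at the observed features `f` and a martingale
difference. -/
lemma gap_linearCost_sub (mdp : LinearMDP S A d H) (π π' : Policy S A H)
    (w w' Φ f : Fin H → Fin d → ℝ) :
    mdp.gap π π' (linearCost mdp.φ w') = mdp.gap π π' (linearCost mdp.φ w) +
      (∑ h, (Φ h - meanFeatures mdp π' h) ⬝ᵥ (w' h - w h) +
        ∑ h, (Φ h - f h) ⬝ᵥ (w h - w' h) +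
        (∑ h, f h ⬝ᵥ (w h - w' h) - ∑ h, meanFeatures mdp π h ⬝ᵥ (w h - w' h))) := by
  rw [gap_linearCost_eq, gap_linearCost_eq, ← Finset.sum_sub_distrib, ← Finset.sum_add_distrib,
    ← Finset.sum_add_distrib, ← Finset.sum_add_distrib]
  refine Finset.sum_congr rfl fun h _ => ?_
  simp only [sub_dotProduct, dotProduct_sub]
  ring

/-- The regret of the cost player of BRIG with step size `1 / √(2K)`. -/
lemma sum_ogd_regret_le {A : Type v} (mdp : LinearMDP S A d H) (hd : 1 ≤ d) {Wset : Set (Fin d → ℝ)}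
    (hW : Wset = unitBox d ∨ Wset = unitBall d) {w₁ wtrue : Fin H → Fin d → ℝ}
    (hw₁ : ∀ h, w₁ h ∈ Wset) (hwt : ∀ h, wtrue h ∈ Wset) {N K : ℕ} (hK : 1 ≤ K)
    (D : Fin N → Episode S A H) (run : Fin K → Episode S A H) :
    ∑ k, ∑ h, (expertFeatures mdp.φ D h - mdp.φ (run k h).1 (run k h).2.1) ⬝ᵥ
      (ogd mdp.φ Wset (1 / √(2 * (K : ℝ))) w₁ D k (past run k) h - wtrue h) ≤
      5 * (H * (d * √K)) := by
  have hd' : (1 : ℝ) ≤ d := by exact_mod_cast hd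
  have hK' : (1 : ℝ) ≤ K := by exact_mod_cast hK
  rw [Finset.sum_comm]
  refine (Finset.sum_le_card_nsmul _ _ (5 * (d * √K)) fun h _ => ?_).trans_eq (by simp; ring)
  simp only [ogd_eq_descent]
  set α := 1 / √(2 * (K : ℝ)) with hα
  have h1 := descent_regret_le (projectable_of_eq hW) α w₁
    (fun e h => expertFeatures mdp.φ D h - mdp.φ (e h).1 (e h).2.1) (γ := 4) h
    (fun e => sub_dotProduct_sub_le_four (sum_abs_expertFeatures_le mdp D h)
      (mdp.feature_norm _ _)) (hwt h) run
  have h2 := sub_dotProduct_sub_le (fun i => abs_apply_le_one_of_mem hW (hw₁ h) i)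
    (fun i => abs_apply_le_one_of_mem hW (hwt h) i)
  have h3 : (K : ℝ) * (α ^ 2 * 4) = 2 := by
    rw [hα, div_pow, Real.sq_sqrt (by positivity)]; field_simp; norm_num
  refine le_of_mul_le_mul_left ((le_add_of_nonneg_right (dotProduct_self_nonneg' _)).trans
    (h1.trans ((add_le_add h2 h3.le).trans ?_))) (show 0 < 2 * α by positivity)
  have hs2 : √(2 : ℝ) ≤ 3 / 2 := by
    rw [Real.sqrt_le_left (by norm_num)]; norm_num
  have h4 : 2 * α * (5 * (d * √K)) = 10 * d / √2 := by
    have : 0 < √(K : ℝ) := Real.sqrt_pos.2 (by linarith)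
    rw [hα, Real.sqrt_mul two_pos.le]; field_simp; ring
  rw [h4, le_div_iff₀ (by positivity)]
  nlinarith [Real.sqrt_nonneg 2]

/-- The guarantee of BRIG holds on the event `F < 1` for a nonnegative `F` of expectation at most
`3δ`: the regret of LSVI-UCB, the martingale and the expert data account for `δ` each. -/
lemma exists_weight_brig_le [Nonempty A] (mdp : LinearMDP S A d H) (hH : 1 ≤ H)
    {am : (A → ℝ) → A} (ham : ∀ (q : A → ℝ) (a : A), q (am q) ≤ q a) {δ : ℝ} (hδ : 0 < δ)
    (hδ2 : δ ≤ 1 / 2) {Wset : Set (Fin d → ℝ)} (hW : Wset = unitBox d ∨ Wset = unitBall d)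
    {w₁ wtrue : Fin H → Fin d → ℝ} (hw₁ : ∀ h, w₁ h ∈ Wset) (hwt : ∀ h, wtrue h ∈ Wset)
    (πE : Policy S A H) {ε εE : ℝ} (hε : 0 < ε) (hε1 : ε ≤ 1) (hεE : 0 < εE) {K N : ℕ}
    (hK : (H : ℝ) ^ 4 * (d : ℝ) ^ 3 * Real.log (d * H / (ε * δ)) ^ 2 / ε ^ 2 ≤ K)
    (hN : 2 * (H : ℝ) ^ 2 * d * Real.log (2 * d / δ) / εE ^ 2 ≤ N) :
    ∃ F : (Fin N → Episode S A H) × (Fin K → Episode S A H) → ℝ, (∀ ω, 0 ≤ F ω) ∧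
      expect (mdp.brigLaw πE am (explorationParam 280 d H K δ) Wset (1 / √(2 * (K : ℝ))) w₁ N K)
        F ≤ 3 * δ ∧
      ∀ ω, F ω < 1 → (1 / (K : ℝ)) * ∑ k : Fin K, mdp.gap
        (brig mdp.φ am (explorationParam 280 d H K δ) Wset (1 / √(2 * (K : ℝ))) w₁ ω.1 k
          (past ω.2 k)) πE (linearCost mdp.φ wtrue) ≤ 30000 * (εE + ε) := by
  have hd := one_le_dim mdp hH
  have hd' : (1 : ℝ) ≤ d := by exact_mod_cast hd
  have hH' : (1 : ℝ) ≤ H := by exact_mod_cast hH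
  have hdH : (1 : ℝ) ≤ d * H := one_le_mul_of_one_le_of_one_le hd' hH'
  have hlogpos : 0 < Real.log (d * H / (ε * δ)) := by
    refine Real.log_pos ((one_lt_div (by positivity)).2 ?_)
    nlinarith
  have hKpos : (0 : ℝ) < K := lt_of_lt_of_le (by positivity) hK
  have hK1 : 1 ≤ K := by exact_mod_cast hKpos
  have hK' : (1 : ℝ) ≤ K := by exact_mod_cast hK1
  have hlog2 : 1 / 2 ≤ Real.log 2 := by linarith [Real.log_two_gt_d9]
  set l := Real.log (2 * d / δ) with hl
  have hl1 : 1 / 2 ≤ l := hlog2.trans (Real.log_le_log two_pos (by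
    rw [le_div_iff₀ hδ]; nlinarith))
  have hlδ : Real.log (1 / δ) ≤ 2 * l := by
    have : Real.log (1 / δ) ≤ l := Real.log_le_log (by positivity) (by gcongr; linarith)
    linarith
  have hNpos : (0 : ℝ) < N := lt_of_lt_of_le (by positivity) hN
  have hN1 : 1 ≤ N := by exact_mod_cast hNpos
  set ι := Real.log (d * H * K / δ) with hι
  have hdHK : (1 : ℝ) ≤ d * H * K := one_le_mul_of_one_le_of_one_le hdH hK'
  have hι1 : 1 / 2 ≤ ι := hlog2.trans (Real.log_le_log two_pos (by
    rw [le_div_iff₀ hδ]; nlinarith))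
  have hιδ : Real.log (1 / δ) ≤ 2 * ι := by
    have : Real.log (1 / δ) ≤ ι := Real.log_le_log (by positivity) (by gcongr)
    linarith
  have hdiffN : 20 * √(d : ℝ) * (H * √(l / N)) ≤ 20 * εE := by
    have : √(d : ℝ) * (H * √(l / N)) ≤ εE := by
      refine le_of_sq_le_sq ?_ hεE.le
      rw [div_le_iff₀ (by positivity)] at hN
      rw [mul_pow, mul_pow, Real.sq_sqrt (by positivity), Real.sq_sqrt (by positivity)]
      have e : (d : ℝ) * (H ^ 2 * (l / N)) = H ^ 2 * d * l / N := by ring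
      rw [e, div_le_iff₀ hNpos]
      have : 0 ≤ (H : ℝ) ^ 2 * d * l := by positivity
      linarith
    linarith
  have hrate := mul_sqrt_mul_log_le hd' hH' hKpos hε hε1 hδ (by linarith) hK
  rw [← hι] at hrate
  set β := explorationParam 280 d H K δ with hβ
  set α := 1 / √(2 * (K : ℝ)) with hα
  have hWabs : ∀ (D : Fin N → Episode S A H) k hist h i,
      |ogd mdp.φ Wset α w₁ D k hist h i| ≤ 1 := fun D k hist h i => by
    rw [ogd_eq_descent]
    exact abs_apply_le_one_of_mem hW (descent_mem (projectable_of_eq hW) α hw₁ _ k hist h) i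
  have hwtabs : ∀ h i, |wtrue h i| ≤ 1 := fun h => abs_apply_le_one_of_mem hW (hwt h)
  obtain ⟨Z, hZ0, hZE, hZ⟩ := exists_weight_expertFeatures_le mdp hH πE hN1 hl1 hlδ
  choose f hf0 hfE hf using fun D : Fin N → Episode S A H =>
    exists_weight_regret_le mdp hH ham hδ hδ2 (hWabs D) hK1
  set L : (Fin N → Episode S A H) → Learner S A H := fun D => brig mdp.φ am β Wset α w₁ D with hL
  set Y : (Fin N → Episode S A H) → (j : ℕ) → (Fin j → Episode S A H) → Episode S A H → ℝ :=
    fun D j hist e => ∑ h, mdp.φ (e h).1 (e h).2.1 ⬝ᵥ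
      (ogd mdp.φ Wset α w₁ D j hist h - wtrue h) with hY
  have hYabs : ∀ D j hist e, |Y D j hist e| ≤ 2 * H := fun D j hist e =>
    (Finset.abs_sum_le_sum_abs _ _).trans ((Finset.sum_le_card_nsmul _ _ 2 fun h _ =>
      abs_dotProduct_le_of_l1 (mdp.feature_norm _ _) two_pos.le fun i =>
        (abs_sub _ _).trans ((add_le_add (hWabs D j hist h i) (hwtabs h i)).trans_eq
          one_add_one_eq_two)).trans_eq (by simp; ring))
  have hYdev : ∀ D j hist e,
      |Y D j hist e - expect (mdp.episodeLaw (L D j hist)) (Y D j hist)| ≤ 4 * H :=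
    fun D j hist e => (abs_sub _ _).trans ((add_le_add (hYabs D j hist e)
      (abs_expect_le _ (hYabs D j hist))).trans_eq (by ring))
  have hM := fun D => expect_interact_exp_azuma_le_one mdp (L D) (Y D) (hYdev D)
    (√(ι / K) / (4 * H)) K
  set M : (Fin N → Episode S A H) → (Fin K → Episode S A H) → ℝ := fun D run =>
    Real.exp (√(ι / K) / (4 * H) * (∑ j : Fin K, (Y D j (past run j) (run j) -
      expect (mdp.episodeLaw (L D j (past run j))) (Y D j (past run j)))) -
      K * ((√(ι / K) / (4 * H)) ^ 2 * (4 * H) ^ 2 / 2)) with hMdef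
  refine ⟨fun ω => δ * Z ω.1 + (f ω.1 ω.2 + δ * M ω.1 ω.2), fun ω => ?_, ?_, ?_⟩
  · exact add_nonneg (mul_nonneg hδ.le (hZ0 _)) (add_nonneg (hf0 _ _)
      (mul_nonneg hδ.le (Real.exp_pos _).le))
  · rw [LinearMDP.brigLaw, expect_bind]
    simp only [expect_map]
    calc _ ≤ expect (mdp.interact (fun _ _ => πE) N) (fun D => δ * Z D + (δ + δ * 1)) := by
          refine expect_mono _ fun D => ?_
          rw [expect_add, expect_add, expect_const, expect_const_mul]
          exact add_le_add le_rfl (add_le_add (hfE D)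
            (mul_le_mul_of_nonneg_left (hM D) hδ.le))
      _ = δ * expect (mdp.interact (fun _ _ => πE) N) Z + (δ + δ * 1) := by
          rw [expect_add, expect_const_mul, expect_const]
      _ ≤ δ * 1 + (δ + δ * 1) := by gcongr
      _ = 3 * δ := by ring
  rintro ⟨D, run⟩ hω
  replace hω : δ * Z D + (f D run + δ * M D run) < 1 := hω
  have hM0 : 0 ≤ δ * M D run := mul_nonneg hδ.le (Real.exp_pos _).le
  have hZ0' : 0 ≤ δ * Z D := mul_nonneg hδ.le (hZ0 D)
  have hf0' := hf0 D run
  have hreg := hf D run (by linarith) πE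
  have hexp := hZ D (by rw [lt_div_iff₀ hδ, mul_comm]; linarith)
  have hmart := le_of_exp_azuma_lt (B := 1 / δ) (l := ι) (b := 4 * H) (K := K) (by positivity)
    (by linarith) hKpos hιδ (lt_of_le_of_lt le_rfl
      (show M D run < 1 / δ by rw [lt_div_iff₀ hδ, mul_comm]; linarith))
  clear hω hM hYdev hYabs
  have hogd := sum_ogd_regret_le mdp hd hW hw₁ hwt hK1 D run
  rw [← hα] at hogd
  -- the expert error of every episode, in the rescaled direction `(w_true - w^k) / (2√d)`
  have hsd : 0 < √(d : ℝ) := Real.sqrt_pos.2 (by linarith)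
  have hexpk : ∀ k : Fin K, ∑ h, (expertFeatures mdp.φ D h - meanFeatures mdp πE h) ⬝ᵥ
      (wtrue h - ogd mdp.φ Wset α w₁ D k (past run k) h) ≤ 20 * εE := fun k => by
    have h1 := hexp (fun h => (2 * √(d : ℝ))⁻¹ •
      (wtrue h - ogd mdp.φ Wset α w₁ D k (past run k) h)) (fun h => by
        rw [smul_dotProduct, dotProduct_smul, smul_eq_mul, smul_eq_mul, ← mul_assoc,
          ← pow_two, inv_pow, mul_pow, Real.sq_sqrt (by positivity),
          inv_mul_le_iff₀ (by positivity), mul_one]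
        exact (sub_dotProduct_sub_le (hwtabs h) (hWabs D k _ h)).trans_eq (by norm_num))
    simp only [dotProduct_smul, smul_eq_mul, ← Finset.mul_sum] at h1
    rw [inv_mul_le_iff₀ (by positivity)] at h1
    refine (h1.trans_eq ?_).trans hdiffN
    ring
  have hexpsum := Finset.sum_le_card_nsmul Finset.univ _ (20 * εE) fun k _ => hexpk k
  rw [Finset.card_univ, Fintype.card_fin, nsmul_eq_mul] at hexpsum
  have hsplit : ∑ k : Fin K, mdp.gap (L D k (past run k)) πE (linearCost mdp.φ wtrue) =
      mdp.regret am β (ogd mdp.φ Wset α w₁ D) run πE +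
      (∑ k : Fin K, ∑ h, (expertFeatures mdp.φ D h - meanFeatures mdp πE h) ⬝ᵥ
        (wtrue h - ogd mdp.φ Wset α w₁ D k (past run k) h) +
      ∑ k : Fin K, ∑ h, (expertFeatures mdp.φ D h - mdp.φ (run k h).1 (run k h).2.1) ⬝ᵥ
        (ogd mdp.φ Wset α w₁ D k (past run k) h - wtrue h) +
      ∑ k : Fin K, (Y D k (past run k) (run k) -
        expect (mdp.episodeLaw (L D k (past run k))) (Y D k (past run k)))) := by
    rw [LinearMDP.regret, ← Finset.sum_add_distrib, ← Finset.sum_add_distrib,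
      ← Finset.sum_add_distrib]
    refine Finset.sum_congr rfl fun k _ => ?_
    rw [gap_linearCost_sub mdp _ πE (ogd mdp.φ Wset α w₁ D k (past run k)) wtrue
      (expertFeatures mdp.φ D) (fun h => mdp.φ (run k h).1 (run k h).2.1)]
    rw [← expect_sum_features_dotProduct]
    rfl
  have hbound : ∑ k : Fin K, mdp.gap (L D k (past run k)) πE (linearCost mdp.φ wtrue) ≤
      3000 * (H : ℝ) ^ 2 * (d : ℝ) ^ (3 / 2 : ℝ) * √(K : ℝ) * ι +
        (K * (20 * εE) + 5 * (H * (d * √K)) + 3 * (4 * H) * √(K * ι)) :=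
    hsplit.trans_le (add_le_add hreg (add_le_add (add_le_add hexpsum hogd) hmart))
  have hlow : 5 * (H * (d * √(K : ℝ))) + 3 * (4 * H) * √(K * ι) ≤
      34 * ((H : ℝ) ^ 2 * (d : ℝ) ^ (3 / 2 : ℝ) * √(K : ℝ) * ι) := by
    have hD : (d : ℝ) ≤ (d : ℝ) ^ (3 / 2 : ℝ) := by
      conv_lhs => rw [← Real.rpow_one (d : ℝ)]
      exact Real.rpow_le_rpow_of_exponent_le hd' (by norm_num)
    have hH2 : (H : ℝ) ≤ (H : ℝ) ^ 2 := le_self_pow₀ hH' two_ne_zero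
    have hsι : √ι ≤ 2 * ι := by
      rw [Real.sqrt_le_left (by linarith)]; nlinarith
    have h1 : (H : ℝ) * (d * √K) * 1 ≤ (H : ℝ) ^ 2 * ((d : ℝ) ^ (3 / 2 : ℝ) * √K) * (2 * ι) := by
      gcongr; linarith
    have h2 : (H : ℝ) * (1 * √K) * √ι ≤ (H : ℝ) ^ 2 * ((d : ℝ) ^ (3 / 2 : ℝ) * √K) * (2 * ι) := by
      gcongr; linarith
    rw [Real.sqrt_mul hKpos.le]
    linarith
  rw [one_div, inv_mul_le_iff₀ hKpos]
  refine hbound.trans ?_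
  have h1 : (0 : ℝ) ≤ K * εE := by positivity
  have h2 : (0 : ℝ) ≤ ε * K := by positivity
  linarith

end Guarantee

end Brig

end

theorem mainTheorem6 :
    ∃ c C₀ C : ℝ, 0 < c ∧ 0 < C₀ ∧ 0 < C ∧
      ∀ (S : Type u) (A : Type v) [Fintype S] [Fintype A] [Nonempty A] (d H : ℕ)
        (mdp : Brig.LinearMDP S A d H) (am : (A → ℝ) → A) (δ : ℝ),
        1 ≤ H → (∀ (q : A → ℝ) (a : A), q (am q) ≤ q a) → 0 < δ → δ < 1 →
        -- LSVI-UCB against adaptively changing costs that are revealed one round in advance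
        (∀ (W : Brig.CostPlayer S A d H) (K : ℕ),
          (∀ k hist h i, |W k hist h i| ≤ 1) →
          ENNReal.ofReal (1 - 2 * δ) ≤
            (mdp.interact
              (Brig.lsviUCB mdp.φ am (Brig.explorationParam c d H K δ) W) K).toOuterMeasure
              {run | ∀ πs : Brig.Policy S A H,
                mdp.regret am (Brig.explorationParam c d H K δ) W run πs ≤
                  C * (H : ℝ) ^ 2 * (d : ℝ) ^ (3 / 2 : ℝ) * √(K : ℝ) *
                    Real.log (d * H * K / δ)}) ∧
        -- the guarantee of BRIG
        (∀ (Wset : Set (Fin d → ℝ)) (w₁ wtrue : Fin H → Fin d → ℝ) (πE : Brig.Policy S A H)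
          (ε εE : ℝ) (K N : ℕ),
          (Wset = Brig.unitBox d ∨ Wset = Brig.unitBall d) →
          (∀ h, w₁ h ∈ Wset) → (∀ h, wtrue h ∈ Wset) →
          0 < ε → ε ≤ 1 → 0 < εE →
          C₀ * ((H : ℝ) ^ 4 * (d : ℝ) ^ 3 * Real.log (d * H / (ε * δ)) ^ 2 / ε ^ 2) ≤ K →
          2 * (H : ℝ) ^ 2 * d * Real.log (2 * d / δ) / εE ^ 2 ≤ N →
          ENNReal.ofReal (1 - 3 * δ) ≤
            (mdp.brigLaw πE am (Brig.explorationParam c d H K δ) Wset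
              (1 / √(2 * (K : ℝ))) w₁ N K).toOuterMeasure
              {ω | (1 / (K : ℝ)) * ∑ k : Fin K,
                mdp.gap
                  (Brig.brig mdp.φ am (Brig.explorationParam c d H K δ) Wset
                    (1 / √(2 * (K : ℝ))) w₁ ω.1 k (Brig.past ω.2 k))
                  πE (Brig.linearCost mdp.φ wtrue) ≤ C * (εE + ε)}) := by
  refine ⟨280, 1, 30000, by norm_num, by norm_num, by norm_num, ?_⟩
  intro S A _ _ _ d H mdp am δ hH ham hδ hδ1
  refine ⟨fun W K hW => ?_, fun Wset w₁ wtrue πE ε εE K N hWset hw₁ hwt hε hε1 hεE hK hN => ?_⟩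
  · -- for `δ > 1/2` the claimed probability is not positive
    rcases lt_or_ge (1 / 2) δ with hδ2 | hδ2
    · rw [ENNReal.ofReal_of_nonpos (by linarith)]
      exact zero_le
    rcases Nat.eq_zero_or_pos K with rfl | hKpos
    · refine Brig.ofReal_one_sub_le_toOuterMeasure _ (f := fun _ => 0) (fun _ => le_rfl)
        (fun run _ πs => ?_) (by rw [Brig.expect_const]; positivity)
      simp [Brig.LinearMDP.regret]
    obtain ⟨f, hf0, hfE, hf⟩ := Brig.exists_weight_regret_le mdp hH ham hδ hδ2 hW hKpos
    refine Brig.ofReal_one_sub_le_toOuterMeasure _ hf0 (fun run hrun πs => ?_)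
      (hfE.trans (by linarith))
    refine (hf run hrun πs).trans ?_
    have hd := Brig.one_le_dim mdp hH
    have hlog : 0 ≤ Real.log (d * H * K / δ) := by
      refine Real.log_nonneg ((one_le_div hδ).2 (hδ1.le.trans ?_))
      exact_mod_cast Nat.one_le_iff_ne_zero.2 (by positivity)
    gcongr
    norm_num
  · -- for `δ > 1/2` the claimed probability is not positive
    rcases lt_or_ge (1 / 2) δ with hδ2 | hδ2
    · rw [ENNReal.ofReal_of_nonpos (by linarith)]
      exact zero_le
    rw [one_mul] at hK
    obtain ⟨F, hF0, hFE, hF⟩ := Brig.exists_weight_brig_le mdp hH ham hδ hδ2 hWset hw₁ hwt πE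
      hε hε1 hεE hK hN
    exact Brig.ofReal_one_sub_le_toOuterMeasure _ hF0 hF hFE
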